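/- Let $n\ge 0$, let $a_i=e_{ii}$ be the diagonal matrix units in $\mathfrak{gl}(n,\mathbb R)$, and let $U\subset\mathbb R^n$ be open and connected with $0\in U$ (for instance $U=\mathbb R^n$). A solution on $U$ of the $\mathrm{GL}(n)/\mathrm{O}(n)$-system is a smooth map $\beta$ from $U$ to the real symmetric $n\times n$ matrices with zero diagonal such that $[a_i,\beta_{x_j}]-[a_j,\beta_{x_i}]=[[a_i,\beta],[a_j,\beta]]$ for all $i,j$. (The same definition is used on any open subset of $\mathbb R^n$ containing $0$.) A frame of $\beta$ is a map $E(x,\lambda)\in\mathrm{GL}(n,\mathbb C)$, $x\in U$, $\lambda\in\mathbb C$, differentiable in $x$, with $E^{-1}dE=\sum_i(\lambda a_i+[a_i,\beta])\,dx_i$ and $E(0,\lambda)=\mathrm{Id}$. For $\alpha\in\mathbb C$ and a matrix $N$ with $N^2=0$ put $m_{\alpha,N}(\lambda)=\mathrm{Id}+(\lambda-\alpha)^{-1}N$. Let now $\alpha\in\mathbb R\setminus\{0\}$ and let $N$ be a real $n\times n$ matrix with $N^2=0$. Put $$N'=\Big(\mathrm{Id}-\tfrac1{2\alpha}N\Big)\Big(\mathrm{Id}+\tfrac1{4\alpha^2}N^tN\Big)^{-1}N^t\Big(\mathrm{Id}+\tfrac1{2\alpha}N\Big),\qquad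 s_{\alpha,N}=m_{-\alpha,N'}\,m_{\alpha,N}.$$ Let $\beta$ be a solution on $U$ of the $\mathrm{GL}(n)/\mathrm{O}(n)$-system and $E$ its frame. Put $$E_1(x)=\tfrac{d}{d\lambda}\Big|_{\lambda=\alpha}E(x,\lambda)E(x,\alpha)^{-1},\qquad \tilde N(x)=E(x,\alpha)^{-1}(\mathrm{Id}+NE_1(x))^{-1}NE(x,\alpha),$$ $$\tilde E(x,\lambda)=m_{\alpha,N}(\lambda)E(x,\lambda)m_{\alpha,\tilde N(x)}(\lambda)^{-1},\qquad \tilde E_1(x)=\tfrac{d}{d\lambda}\Big|_{\lambda=-\alpha}\tilde E(x,\lambda)\tilde E(x,-\alpha)^{-1},$$ $$\tilde N'(x)=\tilde E(x,-\alpha)^{-1}(\mathrm{Id}+N'\tilde E_1(x))^{-1}N'\tilde E(x,-\alpha),$$ and let $U'\subset U$ be the set of points at which $\tilde N$ and $\tilde N'$ are well-defined, that is, at which $\mathrm{Id}+NE_1$ and then $\mathrm{Id}+N'\tilde E_1$ are invertible. Then $U'$ is open and contains $0$. On $U'$ the matrix $\tilde N+\tilde N'$ is real, symmetric and has trace zero,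 and $$s_{\alpha,N}*\beta=\beta-(\tilde N+\tilde N')_*$$ is the solution on $U'$ of the $\mathrm{GL}(n)/\mathrm{O}(n)$-system obtained from $\beta$ by dressing with $s_{\alpha,N}$; here $(\cdot)_*$ denotes the off-diagonal part of a matrix (diagonal entries replaced by $0$). That it is obtained by dressing means: it has a frame $\hat E$ such that, for each $x\in U'$, $\hat E(x,\cdot)$ is the result of the dressing action of $s_{\alpha,N}$ on $E(x,\cdot)$. That is, $s_{\alpha,N}$ is a rational loop equal to $\mathrm{Id}$ at $\lambda=\infty$, both $E(x,\cdot)$ and $\hat E(x,\cdot)$ are holomorphic maps $\mathbb C\to\mathrm{GL}(n,\mathbb C)$, and $s_{\alpha,N}E(x,\cdot)=\hat E(x,\cdot)\,\hat g_x$ for a rational loop $\hat g_x$ with $\hat g_x(\infty)=\mathrm{Id}$. Explicitly, $\hat E=s_{\alpha,N}\,E\,m_{\alpha,\tilde N}^{-1}\,m_{-\alpha,\tilde N'}^{-1}$ for $\lambda\ne\pm\alpha$. -/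

import Mathlib

open scoped ContDiff

noncomputable section

namespace NilpotentDressing

/-- The domain of the independent variables `x = (x_1, …, x_n)`. -/
abbrev Pt (n : ℕ) := Fin n → ℝ

/-- Real `n × n` matrices. -/
abbrev RMat (n : ℕ) := Matrix (Fin n) (Fin n) ℝ

/-- Complex `n × n` matrices. -/
abbrev CMat (n : ℕ) := Matrix (Fin n) (Fin n) ℂ

variable {n : ℕ}

/-- A real matrix viewed as a complex one. -/
def toC (A : RMat n) : CMat n := A.map (fun t : ℝ => (t : ℂ))

/-- The off-diagonal part of a matrix: the projection onto the orthogonal complement (for the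
trace form) of the space of diagonal matrices. -/
def offDiag (A : RMat n) : RMat n := Matrix.of fun p q => if p = q then 0 else A p q

/-- The partial derivative `∂F/∂x_i` at `x` of a matrix-valued map, taken entry by entry. -/
def pderiv {𝕜 : Type*} [NormedAddCommGroup 𝕜] [NormedSpace ℝ 𝕜] (i : Fin n)
    (F : Pt n → Matrix (Fin n) (Fin n) 𝕜) (x : Pt n) : Matrix (Fin n) (Fin n) 𝕜 :=
  Matrix.of fun p q => fderiv ℝ (fun y => F y p q) x (Pi.single i 1)

/-! ### The `GL(n)/O(n)`-system -/

/-- The basis element `a_i = e_{ii}` of the space of real diagonal matrices. -/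
def diagUnit (i : Fin n) : RMat n := Matrix.single i i 1

/-- `β` is a smooth solution on `U` of the `GL(n)/O(n)`-system: it takes values in the symmetric
matrices with zero diagonal and satisfies
`[a_i, β_{x_j}] - [a_j, β_{x_i}] = [[a_i, β], [a_j, β]]`. -/
structure IsSolution (U : Set (Pt n)) (β : Pt n → RMat n) : Prop where
  smooth : ∀ p q, ContDiffOn ℝ ∞ (fun x => β x p q) U
  symm : ∀ x ∈ U, (β x).IsSymm
  diag : ∀ x ∈ U, ∀ p, β x p p = 0
  eqn : ∀ x ∈ U, ∀ i j,
    ⁅diagUnit i, pderiv j β x⁆ - ⁅diagUnit j, pderiv i β x⁆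
      = ⁅⁅diagUnit i, β x⁆, ⁅diagUnit j, β x⁆⁆

/-- `E(x, z)` is the frame of `β` on `U`: a `GL(n, ℂ)`-valued solution of
`E⁻¹ dE = ∑ i, (z a_i + [a_i, β]) dx_i`, `E(0, z) = Id`, for every `z ∈ ℂ`. -/
structure IsFrame (U : Set (Pt n)) (β : Pt n → RMat n) (E : Pt n → ℂ → CMat n) : Prop where
  differentiable : ∀ z p q, DifferentiableOn ℝ (fun x => E x z p q) U
  isUnit : ∀ z, ∀ x ∈ U, IsUnit (E x z)
  eqn : ∀ z, ∀ x ∈ U, ∀ i,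
    (E x z)⁻¹ * pderiv i (fun y => E y z) x = z • toC (diagUnit i) + toC ⁅diagUnit i, β x⁆
  init : ∀ z, E 0 z = 1

/-! ### Loops and the dressing action -/

/-- Positive loops: holomorphic maps `ℂ → GL(n, ℂ)`. -/
def IsPosLoop (f : ℂ → CMat n) : Prop :=
  (∀ p q, Differentiable ℂ fun z => f z p q) ∧ ∀ z, IsUnit (f z)

/-- Negative rational loops: the entries are rational functions of `z` (the values at the finitely
many poles being irrelevant), and the value at `∞` is `Id` (so that the determinant does
not vanish identically). -/
def IsNegLoop (g : ℂ → CMat n) : Prop :=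
  (∀ p q, ∃ P Q : Polynomial ℂ, Q ≠ 0 ∧ ∀ z, Q.eval z ≠ 0 → g z p q = P.eval z / Q.eval z) ∧
  ∀ p q, Filter.Tendsto (fun z => g z p q) (Bornology.cobounded ℂ) (nhds ((1 : CMat n) p q))

/-- `f'` is the result `g * f` of the dressing action of the negative loop `g` on the positive
loop `f`: there is a factorization `g f = f' g'` with `f'` positive and `g'` negative, as an
identity of meromorphic functions. -/
def IsDressing (g f f' : ℂ → CMat n) : Prop :=
  IsNegLoop g ∧ IsPosLoop f ∧ IsPosLoop f' ∧
    ∃ g' : ℂ → CMat n, IsNegLoop g' ∧ ∀ᶠ z in Filter.cofinite, g z * f z = f' z * g' z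

/-! ### Nilpotent simple elements -/

/-- `m_{α,1,N}(z) = Id + (z - α)⁻¹ N`. -/
def mElt (α : ℂ) (N : CMat n) (z : ℂ) : CMat n := 1 + (z - α)⁻¹ • N

/-- `N' = (Id - N/(2α)) (Id + NᵗN/(4α²))⁻¹ Nᵗ (Id + N/(2α))`. -/
def twistN (α : ℂ) (N : CMat n) : CMat n :=
  (1 - (2 * α)⁻¹ • N) * (1 + (4 * α ^ 2)⁻¹ • (N.transpose * N))⁻¹ * N.transpose *
    (1 + (2 * α)⁻¹ • N)

/-- `s_{α,N} = m_{-α,1,N'} m_{α,1,N}`. -/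
def sElt (α : ℂ) (N : CMat n) (z : ℂ) : CMat n := mElt (-α) (twistN α N) z * mElt α N z

/-- `f_1 = d/dz|_{z=α} f(z) f(α)⁻¹`. -/
def logCoeff (f : ℂ → CMat n) (α : ℂ) : CMat n :=
  Matrix.of fun p q => deriv (fun z => (f z * (f α)⁻¹) p q) α

/-- `Id + N f_1` is invertible, i.e. `f(α)⁻¹ (Id + N f_1)⁻¹ N f(α)` is well-defined. -/
def WellDefined (f : ℂ → CMat n) (α : ℂ) (N : CMat n) : Prop :=
  IsUnit (1 + N * logCoeff f α)

/-- `f(α)⁻¹ (Id + N f_1)⁻¹ N f(α)`. -/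
def dressN (f : ℂ → CMat n) (α : ℂ) (N : CMat n) : CMat n :=
  (f α)⁻¹ * (1 + N * logCoeff f α)⁻¹ * N * f α

/-- The loop `m_{α,1,N} f m_{α,1,Ñ}⁻¹`, where `Ñ = f(α)⁻¹ (Id + N f_1)⁻¹ N f(α)`; it is only
used away from the point `z = α`. -/
def dressLoop (f : ℂ → CMat n) (α : ℂ) (N : CMat n) (z : ℂ) : CMat n :=
  mElt α N z * f z * (mElt α (dressN f α N) z)⁻¹

/-- `Ñ`, for the loop `f = E(x, ·)`. -/
def tildeN (f : ℂ → CMat n) (α : ℂ) (N : CMat n) : CMat n := dressN f α N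

/-- `Ñ'`, for the loop `f = E(x, ·)`: the same construction for the loop
`Ẽ = m_{α,1,N} f m_{α,1,Ñ}⁻¹`, the point `-α` and the nilpotent matrix `N'`. -/
def tildeN' (f : ℂ → CMat n) (α : ℂ) (N : CMat n) : CMat n :=
  dressN (dressLoop f α N) (-α) (twistN α N)

/-- The set of those `x ∈ U` at which `Ñ(x)` and `Ñ'(x)` are both well-defined. -/
def goodSet (U : Set (Pt n)) (E : Pt n → ℂ → CMat n) (α : ℂ) (N : CMat n) : Set (Pt n) :=
  {x ∈ U | WellDefined (E x) α N ∧ WellDefined (dressLoop (E x) α N) (-α) (twistN α N)}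

end NilpotentDressing

end

open NilpotentDressing

/-! A frame solves `dE = E (z δ + A)` with `δ = ∑ a_i dx_i` and `A = ∑ [a_i, β] dx_i`. The matrix
`Ñ` is precisely what makes `(1 + N/(z - α)) E (1 - Ñ/(z - α))` regular at `z = α`, so the dressed
family is again entire in `z` and invertible (`dressedLoop_of_ne`, `isUnit_dressedLoop`). As a
function of `x`, `Ñ` satisfies a Riccati equation (`IsLaxFrame.hasFDerivAt_dressedNil`), and with it
the dressed family `F` solves `dF = F (z δ + A - [δ, Ñ])`. This has the same shape, so the step can
be repeated at `-α` with `N'` (`IsLaxFrame.dress`). Altogether `[δ, Ñ + Ñ']` is subtracted from `A`;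
since `δ` is diagonal, only the off-diagonal part of `Ñ + Ñ'` counts. Flatness of the new potential
is the system for the new `β`.

It remains to see that `Ñ + Ñ'` is real, symmetric and traceless. The trace vanishes because both
summands are nilpotent. Reality holds because `conj f(conj z) = f(z)` survives each step. For
symmetry, `E(x, -z)ᵗ E(x, z) = 1`, and `N'` is chosen so that `s(-z)ᵗ s(z) = 1`
(`sElt_transpose_mul_sElt`). For the new frame the product `Ê(-z)ᵗ Ê(z)` is then entire and tends to
`1` at infinity, so it is `1` by Liouville, and its `1/z` coefficient gives the symmetry
(`residue_sum_symmetric`).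

The definition of a frame does not include holomorphy in `z`, on which all this rests. At `x = 0`
the frame is constant in `z`; Gronwall estimates propagate differentiability in `z` over the
connected set `U` and give the `x`-derivative of the logarithmic `z`-derivative
(`differentiable_of_linear`, `exists_hasDerivAt_of_linear`). -/

open Filter Topology
open scoped ContDiff

/-! ### Linear equations `dY = Y Ω` in a normed algebra: Gronwall estimates. -/

section LinearEquations

variable {X 𝔸 : Type*} [NormedAddCommGroup X] [NormedSpace ℝ X] [NormedRing 𝔸]
  [NormedAlgebra ℝ 𝔸]

/-- The `1`-form `a L`, for an algebra-valued `1`-form `L`. -/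
noncomputable def leftMul (a : 𝔸) (L : X →L[ℝ] 𝔸) : X →L[ℝ] 𝔸 := (ContinuousLinearMap.mul ℝ 𝔸 a).comp L

/-- The `1`-form `L a`, for an algebra-valued `1`-form `L`. -/
noncomputable def rightMul (L : X →L[ℝ] 𝔸) (a : 𝔸) : X →L[ℝ] 𝔸 :=
  ((ContinuousLinearMap.mul ℝ 𝔸).flip a).comp L

@[simp] theorem leftMul_apply (a : 𝔸) (L : X →L[ℝ] 𝔸) (v : X) : leftMul a L v = a * L v := rfl

@[simp] theorem rightMul_apply (L : X →L[ℝ] 𝔸) (a : 𝔸) (v : X) : rightMul L a v = L v * a := rfl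

theorem norm_leftMul_le (a : 𝔸) (L : X →L[ℝ] 𝔸) : ‖leftMul a L‖ ≤ ‖a‖ * ‖L‖ := by
  refine ContinuousLinearMap.opNorm_le_bound _ (by positivity) fun v => ?_
  rw [leftMul_apply]
  calc ‖a * L v‖ ≤ ‖a‖ * ‖L v‖ := norm_mul_le _ _
    _ ≤ ‖a‖ * (‖L‖ * ‖v‖) := by gcongr; exact L.le_opNorm v
    _ = _ := by ring

theorem norm_rightMul_le (L : X →L[ℝ] 𝔸) (a : 𝔸) : ‖rightMul L a‖ ≤ ‖L‖ * ‖a‖ := by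
  refine ContinuousLinearMap.opNorm_le_bound _ (by positivity) fun v => ?_
  rw [rightMul_apply]
  calc ‖L v * a‖ ≤ ‖L v‖ * ‖a‖ := norm_mul_le _ _
    _ ≤ (‖L‖ * ‖v‖) * ‖a‖ := by gcongr; exact L.le_opNorm v
    _ = _ := by ring

theorem HasFDerivAt.mul_leftMul {a b : X → 𝔸} {a' b' : X →L[ℝ] 𝔸} {x : X}
    (ha : HasFDerivAt a a' x) (hb : HasFDerivAt b b' x) :
    HasFDerivAt (fun y => a y * b y) (leftMul (a x) b' + rightMul a' (b x)) x :=
  (ha.mul' hb).congr_fderiv (by ext v; simp)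

/-- Two solutions of linear equations `dY = Y Ω`, `dY' = Y' Ω'` stay close to each other. -/
theorem norm_sub_le_of_linear {s : Set X} (hs : Convex ℝ s) {Y Y' : X → 𝔸}
    {Ω Ω' : X → X →L[ℝ] 𝔸} {M K ε : ℝ} (hM : 1 ≤ M) (hK : 0 ≤ K) (hε : 0 ≤ ε)
    (hY : ∀ x ∈ s, HasFDerivAt Y (leftMul (Y x) (Ω x)) x)
    (hY' : ∀ x ∈ s, HasFDerivAt Y' (leftMul (Y' x) (Ω' x)) x)
    (hΩ : ∀ x ∈ s, ‖Ω x‖ ≤ M) (hd : ∀ x ∈ s, ‖Ω x - Ω' x‖ ≤ ε) (hb : ∀ x ∈ s, ‖Y' x‖ ≤ K)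
    {x₀ x : X} (hx₀ : x₀ ∈ s) (hx : x ∈ s) (h1 : ‖x - x₀‖ ≤ 1) :
    ‖Y x - Y' x‖ ≤ (‖Y x₀ - Y' x₀‖ + K * ε) * Real.exp M := by
  -- Along the segment from `x₀` to `x`, Gronwall's inequality applies to `Y - Y'`.
  set p : ℝ → X := fun t => x₀ + t • (x - x₀) with hp
  have hps : ∀ t ∈ Set.Icc (0 : ℝ) 1, p t ∈ s := fun t ht => by
    have := hs.add_smul_sub_mem hx₀ hx ht
    exact this
  have hpd : ∀ t, HasDerivAt p (x - x₀) t := fun t => by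
    have := ((hasDerivAt_id t).smul_const (x - x₀)).const_add x₀
    rw [one_smul] at this
    exact this
  set f : ℝ → 𝔸 := fun t => Y (p t) - Y' (p t)
  have hf : ∀ t ∈ Set.Icc (0 : ℝ) 1, HasDerivAt f
      ((leftMul (Y (p t)) (Ω (p t))) (x - x₀) - (leftMul (Y' (p t)) (Ω' (p t))) (x - x₀)) t := fun t ht =>
    ((hY _ (hps t ht)).comp_hasDerivAt t (hpd t)).sub
      ((hY' _ (hps t ht)).comp_hasDerivAt t (hpd t))
  have key := norm_le_gronwallBound_of_norm_deriv_right_le (f := f) (δ := ‖Y x₀ - Y' x₀‖)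
    (K := M) (ε := K * ε) (a := 0) (b := 1)
    (fun t ht => (hf t ht).continuousAt.continuousWithinAt)
    (fun t ht => (hf t ⟨ht.1, ht.2.le⟩).hasDerivWithinAt) (by simp [f, hp]) ?_ 1 (by simp)
  · have hf1 : f 1 = Y x - Y' x := by simp [f, hp]
    rw [hf1, gronwallBound_of_K_ne_0 (by linarith)] at key
    refine key.trans ?_
    have h2 : K * ε / M ≤ K * ε := div_le_self (by positivity) hM
    have h3 : 1 ≤ Real.exp M := Real.one_le_exp (by linarith)
    have h4 : K * ε / M * (Real.exp M - 1) ≤ K * ε * Real.exp M :=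
      mul_le_mul h2 (by linarith) (by linarith) (by positivity)
    simp only [sub_zero, mul_one]
    linarith
  · intro t ht
    have hq := hps t ⟨ht.1, ht.2.le⟩
    -- With this splitting, a priori bounds are needed for `Ω` and `Y'`, but not for `Y`.
    have e : (leftMul (Y (p t)) (Ω (p t))) (x - x₀) - (leftMul (Y' (p t)) (Ω' (p t))) (x - x₀)
        = f t * Ω (p t) (x - x₀) + Y' (p t) * (Ω (p t) - Ω' (p t)) (x - x₀) := by
      simp [f]; noncomm_ring
    rw [e]
    refine (norm_add_le _ _).trans (add_le_add ?_ ?_)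
    · calc _ ≤ ‖f t‖ * ‖Ω (p t) (x - x₀)‖ := norm_mul_le _ _
        _ ≤ ‖f t‖ * (‖Ω (p t)‖ * ‖x - x₀‖) := by gcongr; exact (Ω (p t)).le_opNorm _
        _ ≤ ‖f t‖ * (M * 1) := by gcongr; exact hΩ _ hq
        _ = _ := by ring
    · calc _ ≤ ‖Y' (p t)‖ * ‖(Ω (p t) - Ω' (p t)) (x - x₀)‖ := norm_mul_le _ _
        _ ≤ ‖Y' (p t)‖ * (‖Ω (p t) - Ω' (p t)‖ * ‖x - x₀‖) := by
          gcongr; exact (Ω (p t) - Ω' (p t)).le_opNorm _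
        _ ≤ K * (ε * 1) := by gcongr; exacts [hb _ hq, hd _ hq]
        _ = _ := by ring

theorem norm_le_of_linear {s : Set X} (hs : Convex ℝ s) {Y : X → 𝔸}
    {Ω : X → X →L[ℝ] 𝔸} {M : ℝ} (hM : 1 ≤ M)
    (hY : ∀ x ∈ s, HasFDerivAt Y (leftMul (Y x) (Ω x)) x) (hΩ : ∀ x ∈ s, ‖Ω x‖ ≤ M)
    {x₀ x : X} (hx₀ : x₀ ∈ s) (hx : x ∈ s) (h1 : ‖x - x₀‖ ≤ 1) :
    ‖Y x‖ ≤ ‖Y x₀‖ * Real.exp M := by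
  -- The zero map solves the same equation, so both `K` and `ε` can be `0`.
  have := norm_sub_le_of_linear hs (Y' := fun _ => 0) (Ω' := Ω) (K := 0) (ε := 0) hM le_rfl le_rfl
    hY (fun x _ => (hasFDerivAt_const (0 : 𝔸) x).congr_fderiv (by ext; simp)) hΩ (by simp) (by simp) hx₀ hx h1
  simpa using this

theorem HasFDerivAt.ringInverse_of_linear [CompleteSpace 𝔸] {Y : X → 𝔸} {Ω : X →L[ℝ] 𝔸} {x : X}
    (hY : HasFDerivAt Y (leftMul (Y x) Ω) x) (hu : IsUnit (Y x)) :
    HasFDerivAt (fun y => Ring.inverse (Y y)) (-(rightMul Ω (Ring.inverse (Y x)))) x := by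
  obtain ⟨u, hu⟩ := hu
  have h := (hasFDerivAt_ringInverse (𝕜 := ℝ) u)
  rw [hu] at h
  refine (h.comp x hY).congr_fderiv ?_
  ext v
  simp [← hu]

end LinearEquations

theorem tendstoUniformlyOn_of_norm_sub_le {ι X E : Type*} [SeminormedAddCommGroup E] {l : Filter ι}
    {s : Set X} {F : ι → X → E} {f : X → E} {b : ι → ℝ} (hb : Tendsto b l (𝓝 0))
    (h : ∀ᶠ i in l, ∀ x ∈ s, ‖F i x - f x‖ ≤ b i) : TendstoUniformlyOn F f l s := by
  rw [Metric.tendstoUniformlyOn_iff]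
  intro ε hε
  filter_upwards [h, hb.eventually (gt_mem_nhds hε)] with i hi hbi x hx
  rw [dist_eq_norm, norm_sub_rev]
  exact (hi x hx).trans_lt hbi

/-! ### Dependence of solutions on the spectral parameter. -/

section SpectralFamilies

variable {X 𝔸 : Type*} [NormedAddCommGroup X] [NormedSpace ℝ X] [NormedRing 𝔸]
  [NormedAlgebra ℂ 𝔸]

theorem norm_pencil_le {δ L : X →L[ℝ] 𝔸} {z z₀ : ℂ} {M : ℝ} (hL : ‖L‖ ≤ M)
    (hz : ‖z - z₀‖ ≤ 1) : ‖z • δ + L‖ ≤ (‖z₀‖ + 1) * ‖δ‖ + M + 1 := by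
  have h1 : ‖z‖ ≤ ‖z₀‖ + 1 := by
    have := norm_add_le (z - z₀) z₀
    rw [sub_add_cancel] at this
    linarith
  calc ‖z • δ + L‖ ≤ ‖z • δ‖ + ‖L‖ := norm_add_le _ _
    _ = ‖z‖ * ‖δ‖ + ‖L‖ := by rw [norm_smul]
    _ ≤ (‖z₀‖ + 1) * ‖δ‖ + M := by gcongr
    _ ≤ _ := by linarith

theorem norm_pencil_sub_le (δ L : X →L[ℝ] 𝔸) (z w : ℂ) :
    ‖(z • δ + L) - (w • δ + L)‖ ≤ ‖z - w‖ * ‖δ‖ := by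
  have e : (z • δ + L) - (w • δ + L) = (z - w) • δ := by
    ext v
    simp [sub_smul]
  rw [e, norm_smul]

/-- A pointwise limit, for `z → z₀`, of solutions of `dY = Y (z δ + A)` is locally uniform, with an
explicit rate. -/
theorem norm_sub_le_of_tendsto {s : Set X} (hs : Convex ℝ s) {δ : X →L[ℝ] 𝔸}
    {A : X → X →L[ℝ] 𝔸} {M : ℝ} (hM : 0 ≤ M) (hA : ∀ x ∈ s, ‖A x‖ ≤ M) {Y : ℂ → X → 𝔸}
    {z₀ : ℂ} {l : Filter ℂ} [l.NeBot] (hl : l ≤ 𝓝 z₀)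
    (hY : ∀ᶠ z in l, ∀ x ∈ s, HasFDerivAt (Y z) (leftMul (Y z x) (z • δ + A x)) x) {Y₀ : X → 𝔸}
    (hY₀ : ∀ x ∈ s, Tendsto (fun z => Y z x) l (𝓝 (Y₀ x))) {x₀ : X} (hx₀ : x₀ ∈ s)
    (h1 : ∀ x ∈ s, ‖x - x₀‖ ≤ 1) :
    ∃ C : ℝ, (∀ x ∈ s, ‖Y₀ x‖ ≤ C) ∧ ∀ᶠ z in l, ∀ x ∈ s,
      ‖Y z x - Y₀ x‖ ≤ C * (‖Y z x₀ - Y₀ x₀‖ + ‖z - z₀‖) := by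
  set M' := (‖z₀‖ + 1) * ‖δ‖ + M + 1 with hM'
  have hM1 : 1 ≤ M' := by rw [hM']; have : 0 ≤ (‖z₀‖ + 1) * ‖δ‖ := by positivity
                          linarith
  set K := (‖Y₀ x₀‖ + 1) * Real.exp M' with hK
  have hK0 : 0 ≤ K := by positivity
  have hz : ∀ᶠ z in l, ‖z - z₀‖ ≤ 1 := by
    filter_upwards [hl (Metric.closedBall_mem_nhds z₀ one_pos)] with z hz
    simpa [dist_eq_norm] using hz
  have hY1 : ∀ᶠ z in l, ‖Y z x₀‖ ≤ ‖Y₀ x₀‖ + 1 :=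
    (hY₀ x₀ hx₀).norm.eventually (eventually_le_nhds (by linarith))
  have hbd : ∀ᶠ z in l, ∀ x ∈ s, ‖Y z x‖ ≤ K := by
    filter_upwards [hz, hY1, hY] with z hz h2 h3 x hx
    refine (norm_le_of_linear hs hM1 h3 (fun x hx => norm_pencil_le (hA x hx) hz) hx₀ hx
      (h1 x hx)).trans ?_
    rw [hK]; gcongr
  -- `Y₀` is not yet known to solve an equation, so `Y z` is compared with `Y z'`, and `z'` tends to
  -- `z₀` afterwards.
  have hpair : ∀ᶠ z in l, ∀ᶠ z' in l, ∀ x ∈ s,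
      ‖Y z x - Y z' x‖ ≤ (‖Y z x₀ - Y z' x₀‖ + K * (‖z - z'‖ * ‖δ‖)) * Real.exp M' := by
    filter_upwards [hz, hY] with z hz h3
    filter_upwards [hbd, hY] with z' hb' h3' x hx
    refine norm_sub_le_of_linear hs hM1 hK0 (by positivity) h3 h3'
      (fun x hx => norm_pencil_le (hA x hx) hz) (fun x _ => ?_) hb' hx₀ hx (h1 x hx)
    exact norm_pencil_sub_le _ _ _ _
  refine ⟨max K (Real.exp M' * max 1 (K * ‖δ‖)), fun x hx => ?_, ?_⟩
  · refine le_trans ?_ (le_max_left _ _)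
    exact le_of_tendsto (hY₀ x hx).norm (hbd.mono fun z h => h x hx)
  · filter_upwards [hpair] with z hz x hx
    have hlim : Tendsto (fun z' => (‖Y z x₀ - Y z' x₀‖ + K * (‖z - z'‖ * ‖δ‖)) * Real.exp M') l
        (𝓝 ((‖Y z x₀ - Y₀ x₀‖ + K * (‖z - z₀‖ * ‖δ‖)) * Real.exp M')) := by
      refine Tendsto.mul_const _ (Tendsto.add ((tendsto_const_nhds.sub (hY₀ x₀ hx₀)).norm) ?_)
      exact ((tendsto_const_nhds.sub (tendsto_id'.2 hl)).norm.mul_const _).const_mul _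
    have h5 := le_of_tendsto_of_tendsto (tendsto_const_nhds.sub (hY₀ x hx)).norm hlim
      (hz.mono fun z' h => h x hx)
    refine h5.trans ?_
    have a1 : ‖Y z x₀ - Y₀ x₀‖ ≤ max 1 (K * ‖δ‖) * ‖Y z x₀ - Y₀ x₀‖ :=
      le_mul_of_one_le_left (norm_nonneg _) (le_max_left _ _)
    have a2 : K * (‖z - z₀‖ * ‖δ‖) ≤ max 1 (K * ‖δ‖) * ‖z - z₀‖ := by
      calc _ = (K * ‖δ‖) * ‖z - z₀‖ := by ring
        _ ≤ _ := by gcongr; exact le_max_right _ _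
    calc _ ≤ (max 1 (K * ‖δ‖) * ‖Y z x₀ - Y₀ x₀‖ + max 1 (K * ‖δ‖) * ‖z - z₀‖)
          * Real.exp M' := by gcongr
      _ = (Real.exp M' * max 1 (K * ‖δ‖)) * (‖Y z x₀ - Y₀ x₀‖ + ‖z - z₀‖) := by ring
      _ ≤ _ := by gcongr; exact le_max_right _ _

/-- A pointwise limit, for `z → z₀`, of solutions of `dY = Y (z δ + A)` solves
`dY = Y (z₀ δ + A)`. -/
theorem hasFDerivAt_of_tendsto_linear {s : Set X} (hs : Convex ℝ s) (hso : IsOpen s)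
    {δ : X →L[ℝ] 𝔸} {A : X → X →L[ℝ] 𝔸} {M : ℝ} (hM : 0 ≤ M) (hA : ∀ x ∈ s, ‖A x‖ ≤ M)
    {Y : ℂ → X → 𝔸} {z₀ : ℂ} {l : Filter ℂ} [l.NeBot] (hl : l ≤ 𝓝 z₀)
    (hY : ∀ᶠ z in l, ∀ x ∈ s, HasFDerivAt (Y z) (leftMul (Y z x) (z • δ + A x)) x) {Y₀ : X → 𝔸}
    (hY₀ : ∀ x ∈ s, Tendsto (fun z => Y z x) l (𝓝 (Y₀ x))) {x₀ : X} (hx₀ : x₀ ∈ s)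
    (h1 : ∀ x ∈ s, ‖x - x₀‖ ≤ 1) {x : X} (hx : x ∈ s) :
    HasFDerivAt Y₀ (leftMul (Y₀ x) (z₀ • δ + A x)) x := by
  obtain ⟨C, hC, hb⟩ := norm_sub_le_of_tendsto hs hM hA hl hY hY₀ hx₀ h1
  set M' := (‖z₀‖ + 1) * ‖δ‖ + M + 1 with hM'
  have hM1 : 0 ≤ M' := by positivity
  have hz : ∀ᶠ z in l, ‖z - z₀‖ ≤ 1 := by
    filter_upwards [hl (Metric.closedBall_mem_nhds z₀ one_pos)] with z hz
    simpa [dist_eq_norm] using hz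
  have hz0 : Tendsto (fun z => ‖z - z₀‖) l (𝓝 0) := by
    have := ((tendsto_id'.2 hl).sub_const z₀).norm
    simpa using this
  have hr : Tendsto (fun z => C * (‖Y z x₀ - Y₀ x₀‖ + ‖z - z₀‖)) l (𝓝 0) := by
    have := ((((hY₀ x₀ hx₀).sub_const (Y₀ x₀)).norm).add hz0).const_mul C
    simpa using this
  have hu : TendstoUniformlyOn (fun z x => leftMul (Y z x) (z • δ + A x))
      (fun x => leftMul (Y₀ x) (z₀ • δ + A x)) l s := by
    refine tendstoUniformlyOn_of_norm_sub_le
      (b := fun z => C * (‖Y z x₀ - Y₀ x₀‖ + ‖z - z₀‖) * M' + C * (‖z - z₀‖ * ‖δ‖)) ?_ ?_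
    · have := (hr.mul_const M').add ((hz0.mul_const ‖δ‖).const_mul C)
      simpa using this
    · filter_upwards [hb, hz] with z hb hz x hx
      have e : leftMul (Y z x) (z • δ + A x) - leftMul (Y₀ x) (z₀ • δ + A x)
          = leftMul (Y z x - Y₀ x) (z • δ + A x) + leftMul (Y₀ x) ((z - z₀) • δ) := by
        ext v
        simp only [sub_apply, add_apply, smul_apply, leftMul_apply, sub_smul, mul_add, sub_mul, mul_sub]
        abel
      rw [e]
      refine (norm_add_le _ _).trans (add_le_add ?_ ?_)
      · refine (norm_leftMul_le _ _).trans ?_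
        exact mul_le_mul (hb x hx) (norm_pencil_le (hA x hx) hz) (norm_nonneg _)
          ((norm_nonneg _).trans (hb x hx))
      · refine (norm_leftMul_le _ _).trans ?_
        rw [norm_smul]
        gcongr
        exact hC x hx
  refine hasFDerivAt_of_tendstoUniformlyOnFilter (l := l) (f := Y)
    (f' := fun z x => leftMul (Y z x) (z • δ + A x))
    (g' := fun x => leftMul (Y₀ x) (z₀ • δ + A x)) ?_ ?_ ?_
  · exact hu.tendstoUniformlyOnFilter.mono_right (le_principal_iff.2 (hso.mem_nhds hx))
  · rw [eventually_prod_iff]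
    exact ⟨_, hY, fun y => y ∈ s, hso.mem_nhds hx, fun h y hy => h y hy⟩
  · filter_upwards [hso.mem_nhds hx] with y hy using hY₀ y hy

/-- If the solutions `E(·, z)` of `dE = E (z δ + A)` depend holomorphically on `z` at one point
`x₀`, they do so at all points, and the logarithmic derivative `q = E_z E⁻¹` satisfies
`dq = E δ E⁻¹`. -/
theorem exists_hasDerivAt_of_linear [CompleteSpace 𝔸] {s : Set X} (hs : Convex ℝ s)
    (hso : IsOpen s) {δ : X →L[ℝ] 𝔸} {A : X → X →L[ℝ] 𝔸} {M : ℝ} (hM : 0 ≤ M)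
    (hA : ∀ x ∈ s, ‖A x‖ ≤ M) {E : X → ℂ → 𝔸} {z₀ : ℂ}
    (hE : ∀ z, ∀ x ∈ s, HasFDerivAt (fun y => E y z) (leftMul (E x z) (z • δ + A x)) x)
    (hu : ∀ x ∈ s, IsUnit (E x z₀)) (hG : ∀ x ∈ s, ‖Ring.inverse (E x z₀)‖ ≤ M) {x₀ : X}
    (hx₀ : x₀ ∈ s) (h1 : ∀ x ∈ s, ‖x - x₀‖ ≤ 1) (hd : DifferentiableAt ℂ (E x₀) z₀) :
    ∃ q : X → 𝔸, ∀ x ∈ s,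
      HasDerivAt (fun z => E x z * Ring.inverse (E x z₀)) (q x) z₀ ∧
      HasFDerivAt q (leftMul (E x z₀) (rightMul δ (Ring.inverse (E x z₀)))) x := by
  set M' := (‖z₀‖ + 1) * ‖δ‖ + M + 1 with hM'
  have hM1 : 1 ≤ M' := by rw [hM']; have : 0 ≤ (‖z₀‖ + 1) * ‖δ‖ := by positivity
                          linarith
  set G : X → 𝔸 := fun x => Ring.inverse (E x z₀) with hGdef
  set K := ‖E x₀ z₀‖ * Real.exp M' with hK
  have hK0 : 0 ≤ K := by positivity
  have hbd : ∀ x ∈ s, ‖E x z₀‖ ≤ K := fun x hx =>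
    norm_le_of_linear hs hM1 (hE z₀) (fun x hx => norm_pencil_le (hA x hx) (by simp)) hx₀ hx
      (h1 x hx)
  have hz : ∀ᶠ z in 𝓝 z₀, ‖z - z₀‖ ≤ 1 := by
    filter_upwards [Metric.closedBall_mem_nhds z₀ one_pos] with z hz
    simpa [dist_eq_norm] using hz
  have hz0 : Tendsto (fun z => ‖z - z₀‖) (𝓝 z₀) (𝓝 0) := by
    have := ((tendsto_id (α := ℂ) (x := 𝓝 z₀)).sub_const z₀).norm
    simpa using this
  set b : ℂ → ℝ := fun z => (‖E x₀ z - E x₀ z₀‖ + K * (‖z - z₀‖ * ‖δ‖)) * Real.exp M' with hbdef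
  have hb0 : Tendsto b (𝓝 z₀) (𝓝 0) := by
    have := ((hd.continuousAt.tendsto.sub_const (E x₀ z₀)).norm.add
      ((hz0.mul_const ‖δ‖).const_mul K)).mul_const (Real.exp M')
    simpa using this
  have hb : ∀ᶠ z in 𝓝 z₀, ∀ x ∈ s, ‖E x z - E x z₀‖ ≤ b z := by
    filter_upwards [hz] with z hz x hx
    refine norm_sub_le_of_linear (Y := fun y => E y z) (Y' := fun y => E y z₀) hs hM1 hK0
      (by positivity) (hE z) (hE z₀)
      (fun x hx => norm_pencil_le (hA x hx) hz) (fun x _ => ?_) hbd hx₀ hx (h1 x hx)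
    exact norm_pencil_sub_le _ _ _ _
  -- Difference quotients of `E(x, z) E(x, z₀)⁻¹` in `z`. The potentials at `z` and `z₀` differ by
  -- `(z - z₀) δ`, so the denominator cancels in the `x`-derivative, leaving `E(x, z) δ E(x, z₀)⁻¹`.
  -- At `z = z₀` the quotient is `0` because `0⁻¹ = 0`; hence the case split in `Q'`.
  set Q : ℂ → X → 𝔸 := fun z x => (z - z₀)⁻¹ • (E x z * G x - 1) with hQ
  set Q' : ℂ → X → X →L[ℝ] 𝔸 := fun z x =>
    if z = z₀ then 0 else leftMul (E x z) (rightMul δ (G x)) with hQ'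
  have hQd : ∀ z, ∀ x ∈ s, HasFDerivAt (Q z) (Q' z x) x := by
    intro z x hx
    by_cases hzz : z = z₀
    · simpa [hQ, hQ', hzz] using hasFDerivAt_const (0 : 𝔸) x
    · have hGx := (hE z₀ x hx).ringInverse_of_linear (hu x hx)
      have hEx := (hE z x hx).mul_leftMul hGx
      refine ((hEx.sub_const 1).const_smul (z - z₀)⁻¹).congr_fderiv ?_
      have hne : z - z₀ ≠ 0 := sub_ne_zero.2 hzz
      simp only [hQ', hzz, if_false]
      ext v
      simp only [smul_apply, add_apply, neg_apply, leftMul_apply, rightMul_apply]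
      rw [inv_smul_eq_iff₀ hne]
      simp only [sub_smul, mul_add, add_mul, mul_neg, smul_mul_assoc, mul_smul_comm,
        mul_assoc]
      abel
  have hQu : TendstoUniformlyOn Q' (fun x => leftMul (E x z₀) (rightMul δ (G x))) (𝓝[≠] z₀) s := by
    refine tendstoUniformlyOn_of_norm_sub_le (b := fun z => b z * (‖δ‖ * M)) ?_ ?_
    · have := (hb0.mono_left nhdsWithin_le_nhds (y := 𝓝[≠] z₀)).mul_const (‖δ‖ * M)
      simpa using this
    · filter_upwards [nhdsWithin_le_nhds hb, self_mem_nhdsWithin] with z hbz hzz x hx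
      simp only [hQ', if_neg (show ¬ z = z₀ from hzz)]
      have e : leftMul (E x z) (rightMul δ (G x)) - leftMul (E x z₀) (rightMul δ (G x))
          = leftMul (E x z - E x z₀) (rightMul δ (G x)) := by ext v; simp [sub_mul]
      rw [e]
      refine (norm_leftMul_le _ _).trans ?_
      refine mul_le_mul (hbz x hx) ((norm_rightMul_le _ _).trans ?_) (norm_nonneg _)
        ((norm_nonneg _).trans (hbz x hx))
      gcongr
      exact hG x hx
  have hslope : ∀ x ∈ s, ∀ z, slope (fun z => E x z * G x) z₀ z = Q z x := by
    intro x hx z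
    simp [hQ, slope, hGdef, Ring.mul_inverse_cancel _ (hu x hx)]
  -- Convergence at the single point `x₀`, with uniform convergence of the `x`-derivatives, gives
  -- convergence on all of `s`.
  have hc0 : Cauchy (map (fun z => Q z x₀) (𝓝[≠] z₀)) := by
    have h := hasDerivAt_iff_tendsto_slope.1 (hd.hasDerivAt.mul_const (G x₀))
    have : Tendsto (fun z => Q z x₀) (𝓝[≠] z₀) (𝓝 (deriv (E x₀) z₀ * G x₀)) :=
      h.congr (fun z => hslope x₀ hx₀ z)
    exact this.cauchy_map
  have hlim : ∀ x ∈ s, ∃ y, Tendsto (fun z => Q z x) (𝓝[≠] z₀) (𝓝 y) := fun x hx =>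
    cauchy_map_iff_exists_tendsto.1 (cauchy_map_of_uniformCauchySeqOn_fderiv hso hs.isPreconnected
      hQu.uniformCauchySeqOn hQd hx₀ hx hc0)
  choose! q hq using hlim
  refine ⟨q, fun x hx => ⟨?_, ?_⟩⟩
  · rw [hasDerivAt_iff_tendsto_slope]
    exact (hq x hx).congr fun z => (hslope x hx z).symm
  · exact hasFDerivAt_of_tendstoLocallyUniformlyOn hso hQu.tendstoLocallyUniformlyOn hQd hq hx

end SpectralFamilies

/-! ### Holomorphy in the spectral parameter. -/

section LaxFrames

variable {X 𝔸 : Type*} [NormedAddCommGroup X] [NormedSpace ℝ X] [NormedRing 𝔸]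
  [NormedAlgebra ℂ 𝔸]

omit [NormedSpace ℝ X] in
theorem exists_ball_norm_le {F G : Type*} [NormedAddCommGroup F] [NormedAddCommGroup G] {V : Set X}
    (hV : IsOpen V) {f : X → F} {g : X → G} (hf : ContinuousOn f V) (hg : ContinuousOn g V) {x : X}
    (hx : x ∈ V) : ∃ r > 0, Metric.ball x r ⊆ V ∧ (∀ y ∈ Metric.ball x r, ∀ w ∈ Metric.ball x r,
      ‖y - w‖ ≤ 1) ∧ ∃ M : ℝ, 0 ≤ M ∧ ∀ y ∈ Metric.ball x r, ‖f y‖ ≤ M ∧ ‖g y‖ ≤ M := by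
  have h1 : ∀ᶠ y in 𝓝 x, ‖f y‖ ≤ ‖f x‖ + 1 :=
    (hf.continuousAt (hV.mem_nhds hx)).norm.eventually (eventually_le_nhds (by linarith))
  have h2 : ∀ᶠ y in 𝓝 x, ‖g y‖ ≤ ‖g x‖ + 1 :=
    (hg.continuousAt (hV.mem_nhds hx)).norm.eventually (eventually_le_nhds (by linarith))
  obtain ⟨r, hr, h⟩ := Metric.eventually_nhds_iff_ball.1 ((h1.and h2).and (hV.mem_nhds hx))
  have hsub : Metric.ball x (min r (1 / 2)) ⊆ Metric.ball x r :=
    Metric.ball_subset_ball (min_le_left _ _)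
  refine ⟨min r (1 / 2), by positivity, fun y hy => (h y (hsub hy)).2, fun y hy w hw => ?_,
    max (‖f x‖ + 1) (‖g x‖ + 1), le_max_of_le_left (by positivity), fun y hy =>
      ⟨(h y (hsub hy)).1.1.trans (le_max_left _ _), (h y (hsub hy)).1.2.trans (le_max_right _ _)⟩⟩
  have hy' : dist y x < 1 / 2 := lt_of_lt_of_le hy (min_le_right _ _)
  have hw' : dist w x < 1 / 2 := lt_of_lt_of_le hw (min_le_right _ _)
  rw [← dist_eq_norm]
  linarith [dist_triangle_right y w x]

section Complete

variable [CompleteSpace 𝔸]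

/-- The ball does not depend on the point `x₀` at which differentiability is known. Hence the set of
`x` with `E(x, ·)` differentiable at `z₀` is relatively closed as well as open. -/
theorem exists_local_hasDerivAt {V : Set X} (hV : IsOpen V) {δ : X →L[ℝ] 𝔸}
    {A : X → X →L[ℝ] 𝔸} (hA : ContinuousOn A V) {E : X → ℂ → 𝔸}
    (hE : ∀ x ∈ V, ∀ z, HasFDerivAt (fun y => E y z) (leftMul (E x z) (z • δ + A x)) x)
    (hu : ∀ x ∈ V, ∀ z, IsUnit (E x z)) (z₀ : ℂ) {x₁ : X} (hx₁ : x₁ ∈ V) :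
    ∃ r > 0, Metric.ball x₁ r ⊆ V ∧ ∀ x₀ ∈ Metric.ball x₁ r, DifferentiableAt ℂ (E x₀) z₀ →
      ∃ q : X → 𝔸, ∀ x ∈ Metric.ball x₁ r,
        HasDerivAt (fun z => E x z * Ring.inverse (E x z₀)) (q x) z₀ ∧
        HasFDerivAt q (leftMul (E x z₀) (rightMul δ (Ring.inverse (E x z₀)))) x := by
  have hG : ContinuousOn (fun x => Ring.inverse (E x z₀)) V := fun x hx =>
    ((hE x hx z₀).ringInverse_of_linear (hu x hx z₀)).continuousAt.continuousWithinAt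
  obtain ⟨r, hr, hsub, h1, M, hM, hb⟩ := exists_ball_norm_le hV hA hG hx₁
  exact ⟨r, hr, hsub, fun x₀ hx₀ hd => exists_hasDerivAt_of_linear (convex_ball x₁ r)
    Metric.isOpen_ball hM (fun x hx => (hb x hx).1) (fun z x hx => hE x (hsub hx) z)
    (fun x hx => hu x (hsub hx) z₀) (fun x hx => (hb x hx).2) hx₀ (fun x hx => h1 x hx x₀ hx₀) hd⟩

/-- Holomorphic dependence on the spectral parameter propagates along connected sets. -/
theorem differentiable_of_linear {U : Set X} (hU : IsOpen U) (hUc : IsPreconnected U)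
    {δ : X →L[ℝ] 𝔸} {A : X → X →L[ℝ] 𝔸} (hA : ContinuousOn A U) {E : X → ℂ → 𝔸}
    (hE : ∀ x ∈ U, ∀ z, HasFDerivAt (fun y => E y z) (leftMul (E x z) (z • δ + A x)) x)
    (hu : ∀ x ∈ U, ∀ z, IsUnit (E x z)) {x₀ : X} (hx₀ : x₀ ∈ U) (hd : Differentiable ℂ (E x₀))
    {x : X} (hx : x ∈ U) : Differentiable ℂ (E x) := by
  intro z₀
  set S : Set X := {y | y ∈ U ∧ DifferentiableAt ℂ (E y) z₀}
  have hloc : ∀ x₁ ∈ U, ∃ r > 0, Metric.ball x₁ r ⊆ U ∧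
      ∀ y ∈ Metric.ball x₁ r, y ∈ S → Metric.ball x₁ r ⊆ S := by
    intro x₁ hx₁
    obtain ⟨r, hr, hsub, h⟩ := exists_local_hasDerivAt hU hA hE hu z₀ hx₁
    refine ⟨r, hr, hsub, fun y hy hyS w hw => ⟨hsub hw, ?_⟩⟩
    obtain ⟨q, hq⟩ := h y hy hyS.2
    have := (hq w hw).1.differentiableAt.mul_const (E w z₀)
    refine this.congr_of_eventuallyEq (Eventually.of_forall fun z => ?_)
    simp only [mul_assoc, Ring.inverse_mul_cancel _ (hu w (hsub hw) z₀), mul_one]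
  have hSo : IsOpen S := by
    rw [Metric.isOpen_iff]
    intro y hy
    obtain ⟨r, hr, -, h⟩ := hloc y hy.1
    exact ⟨r, hr, h y (Metric.mem_ball_self hr) hy⟩
  refine (hUc.subset_of_closure_inter_subset hSo ⟨x₀, hx₀, hx₀, hd z₀⟩ ?_ hx).2
  rintro y ⟨hyc, hyU⟩
  obtain ⟨r, hr, -, h⟩ := hloc y hyU
  obtain ⟨w, hwS, hw⟩ := Metric.mem_closure_iff.1 hyc r hr
  exact h w (by rwa [Metric.mem_ball']) hwS (Metric.mem_ball_self hr)

/-- `(d/dz f(z) f(α)⁻¹)|_{z = α}`. -/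
noncomputable def logDerivAt (f : ℂ → 𝔸) (α : ℂ) : 𝔸 :=
  deriv (fun z => f z * Ring.inverse (f α)) α

/-- `f(α)⁻¹ (1 + N f₁)⁻¹ N f(α)`, where `f₁` is the logarithmic derivative of `f` at `α`. -/
noncomputable def dressedNil (f : ℂ → 𝔸) (α : ℂ) (N : 𝔸) : 𝔸 :=
  Ring.inverse (f α) * (Ring.inverse (1 + N * logDerivAt f α) * N) * f α

/-- The holomorphic extension of `(1 + (z - α)⁻¹ N) f(z) (1 - (z - α)⁻¹ Ñ)` across `z = α`. -/
noncomputable def dressedLoop (f : ℂ → 𝔸) (α : ℂ) (N : 𝔸) : ℂ → 𝔸 :=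
  dslope (dslope (fun z => ((z - α) • 1 + N) * f z * ((z - α) • 1 - dressedNil f α N)) α) α

theorem differentiable_dslope_dslope {h : ℂ → 𝔸} (hd : Differentiable ℂ h) (α : ℂ) :
    Differentiable ℂ (dslope (dslope h α) α) := by
  have h1 : ∀ g : ℂ → 𝔸, Differentiable ℂ g → Differentiable ℂ (dslope g α) := fun g hg => by
    rw [← differentiableOn_univ] at hg ⊢
    exact (Complex.differentiableOn_dslope univ_mem).2 hg
  exact h1 _ (h1 _ hd)

omit [CompleteSpace 𝔸] in
theorem dslope_dslope_of_ne {h : ℂ → 𝔸} {α : ℂ} (h0 : h α = 0) (h1 : HasDerivAt h 0 α) {z : ℂ}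
    (hz : z ≠ α) : dslope (dslope h α) α z = (z - α)⁻¹ • (z - α)⁻¹ • h z := by
  rw [dslope_of_ne _ hz, slope_def_module, dslope_of_ne _ hz, slope_def_module, dslope_same,
    h1.deriv, h0, sub_zero, sub_zero]

omit [NormedAlgebra ℂ 𝔸] [CompleteSpace 𝔸] in
-- Nilpotency gives `N (1 + N a) = N`. Through this, `Ñ` squares to zero and the double pole of the
-- dressed loop disappears.
theorem one_add_mul_self_inverse {N a : 𝔸} (hN : N * N = 0) (hu : IsUnit (1 + N * a)) :
    N * Ring.inverse (1 + N * a) = N := by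
  have h1 : N * (1 + N * a) = N := by rw [mul_add, ← mul_assoc, hN, zero_mul, add_zero, mul_one]
  calc N * Ring.inverse (1 + N * a) = N * (1 + N * a) * Ring.inverse (1 + N * a) := by rw [h1]
    _ = N := by rw [mul_assoc, Ring.mul_inverse_cancel _ hu, mul_one]

/-! ### Dressing a single loop. -/

section Loop

variable {f : ℂ → 𝔸} {α : ℂ} {N : 𝔸}

omit [CompleteSpace 𝔸] in
theorem dressedNil_mul_self (hf : IsUnit (f α)) (hN : N * N = 0)
    (hu : IsUnit (1 + N * logDerivAt f α)) : dressedNil f α N * dressedNil f α N = 0 := by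
  have h1 := one_add_mul_self_inverse hN hu
  unfold dressedNil
  set R := Ring.inverse (1 + N * logDerivAt f α)
  calc _ = Ring.inverse (f α) * (R * N) * (f α * Ring.inverse (f α)) * (R * N) * f α := by
        noncomm_ring
    _ = Ring.inverse (f α) * R * ((N * R) * N) * f α := by
        rw [Ring.mul_inverse_cancel _ hf]; noncomm_ring
    _ = 0 := by rw [h1, hN]; simp

omit [CompleteSpace 𝔸] in
theorem hasDerivAt_of_logDerivAt (hf : IsUnit (f α)) (hd : Differentiable ℂ f) :
    HasDerivAt f (logDerivAt f α * f α) α := by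
  have h : HasDerivAt (fun z => f z * Ring.inverse (f α)) (logDerivAt f α) α :=
    ((hd α).mul_const _).hasDerivAt
  refine (h.mul_const (f α)).congr_of_eventuallyEq (Eventually.of_forall fun z => ?_)
  simp only [mul_assoc, Ring.inverse_mul_cancel _ hf, mul_one]

theorem hasDerivAt_ringInverse_of_logDerivAt (hf : IsUnit (f α)) (hd : Differentiable ℂ f) :
    HasDerivAt (fun z => Ring.inverse (f z)) (-(Ring.inverse (f α) * logDerivAt f α)) α := by
  obtain ⟨u, hu⟩ := id hf
  have h := hasFDerivAt_ringInverse (𝕜 := ℂ) u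
  rw [hu] at h
  have := h.comp_hasDerivAt α (hasDerivAt_of_logDerivAt hf hd)
  refine this.congr_deriv ?_
  simp [← hu, mul_assoc]

omit [CompleteSpace 𝔸] in
theorem hasDerivAt_pole_mul {g : ℂ → 𝔸} {g' a b : 𝔸} (hg : HasDerivAt g g' α) :
    HasDerivAt (fun z => ((z - α) • 1 + a) * g z * ((z - α) • 1 - b))
      (g α * -b + a * g' * -b + a * g α) α := by
  have h1 : HasDerivAt (fun z : ℂ => (z - α) • (1 : 𝔸)) 1 α := by
    have := ((hasDerivAt_id α).sub_const α).smul_const (1 : 𝔸)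
    rw [one_smul] at this
    exact this
  refine (((h1.add_const a).mul hg).mul (h1.sub_const b)).congr_deriv ?_
  simp only [Pi.mul_apply, sub_self, zero_smul, zero_add, zero_sub, mul_one, one_mul, add_mul]

theorem differentiable_dressedLoop (hd : Differentiable ℂ f) :
    Differentiable ℂ (dressedLoop f α N) := by
  refine differentiable_dslope_dslope ?_ α
  have h1 : Differentiable ℂ (fun z : ℂ => (z - α) • (1 : 𝔸)) :=
    (differentiable_id.sub_const α).smul_const _
  exact ((h1.add_const N).mul hd).mul (h1.sub_const _)

omit [CompleteSpace 𝔸] in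
theorem inv_smul_inv_smul_pole {w : ℂ} (hw : w ≠ 0) (a b c : 𝔸) :
    w⁻¹ • w⁻¹ • ((w • 1 + a) * b * (w • 1 - c)) = (1 + w⁻¹ • a) * b * (1 - w⁻¹ • c) := by
  have h1 : w • (1 : 𝔸) + a = w • (1 + w⁻¹ • a) := by rw [smul_add, smul_inv_smul₀ hw]
  have h2 : w • (1 : 𝔸) - c = w • (1 - w⁻¹ • c) := by rw [smul_sub, smul_inv_smul₀ hw]
  rw [h1, h2, mul_smul_comm, smul_mul_assoc, smul_mul_assoc, inv_smul_smul₀ hw, inv_smul_smul₀ hw]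

omit [CompleteSpace 𝔸] in
-- The numerator vanishes to second order at `α`. With `R = (1 + N f₁)⁻¹` one has `f(α) Ñ = R N
-- f(α)`, so its value is `-N R N f(α) = -N² f(α) = 0` and its derivative is `(N - (1 + N f₁) R N)
-- f(α) = 0`. The second equation is what determines `Ñ`.
theorem dressedLoop_of_ne (hf : IsUnit (f α)) (hd : Differentiable ℂ f) (hN : N * N = 0)
    (hu : IsUnit (1 + N * logDerivAt f α)) {z : ℂ} (hz : z ≠ α) :
    dressedLoop f α N z
      = (1 + (z - α)⁻¹ • N) * f z * (1 - (z - α)⁻¹ • dressedNil f α N) := by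
  have h1 := one_add_mul_self_inverse hN hu
  have h2 : (1 + N * logDerivAt f α) * (Ring.inverse (1 + N * logDerivAt f α) * N) = N := by
    rw [← mul_assoc, Ring.mul_inverse_cancel _ hu, one_mul]
  have h3 : f α * dressedNil f α N = Ring.inverse (1 + N * logDerivAt f α) * N * f α := by
    rw [dressedNil, ← mul_assoc, ← mul_assoc, Ring.mul_inverse_cancel _ hf, one_mul]
  refine (dslope_dslope_of_ne ?_ ?_ hz).trans (inv_smul_inv_smul_pole (sub_ne_zero.2 hz) _ _ _)
  · simp only [sub_self, zero_smul, zero_add, zero_sub, mul_neg, neg_eq_zero]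
    rw [mul_assoc, h3, ← mul_assoc, ← mul_assoc, h1, hN, zero_mul]
  · refine (hasDerivAt_pole_mul (hasDerivAt_of_logDerivAt hf hd)).congr_deriv ?_
    calc _ = (N - (1 + N * logDerivAt f α) * (Ring.inverse (1 + N * logDerivAt f α) * N)) * f α := by
          rw [mul_neg, mul_neg, h3, mul_assoc N, mul_assoc _ (f α), h3]
          noncomm_ring
      _ = 0 := by rw [h2, sub_self, zero_mul]

/-- Off `α` the inverse is `(1 + Ñ/(z - α)) f⁻¹ (1 - N/(z - α))`, whose pole is removable by the
same second-order computation. Both product identities then extend to `α` by continuity. -/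
theorem isUnit_dressedLoop (hf : ∀ z, IsUnit (f z)) (hd : Differentiable ℂ f) (hN : N * N = 0)
    (hu : IsUnit (1 + N * logDerivAt f α)) (z : ℂ) : IsUnit (dressedLoop f α N z) := by
  have hNt := dressedNil_mul_self (hf α) hN hu
  set T := dressedNil f α N with hT
  set k : ℂ → 𝔸 := fun z => ((z - α) • 1 + T) * Ring.inverse (f z) * ((z - α) • 1 - N) with hk
  have hinv : Differentiable ℂ (fun z => Ring.inverse (f z)) := fun z =>
    (hasDerivAt_ringInverse_of_logDerivAt (hf z) hd).differentiableAt
  have h1 : Differentiable ℂ (fun z : ℂ => (z - α) • (1 : 𝔸)) :=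
    (differentiable_id.sub_const α).smul_const _
  have hkd : Differentiable ℂ k := ((h1.add_const T).mul hinv).mul (h1.sub_const _)
  have h3 : T * Ring.inverse (f α)
      = Ring.inverse (f α) * (Ring.inverse (1 + N * logDerivAt f α) * N) := by
    rw [hT, dressedNil, mul_assoc, Ring.mul_inverse_cancel _ (hf α), mul_one]
  have hk0 : k α = 0 := by
    simp only [hk, sub_self, zero_smul, zero_add, zero_sub, mul_neg, neg_eq_zero]
    rw [h3, mul_assoc, mul_assoc, hN, mul_zero, mul_zero]
  have hk1 : HasDerivAt k 0 α := by
    refine (hasDerivAt_pole_mul (hasDerivAt_ringInverse_of_logDerivAt (hf α) hd)).congr_deriv ?_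
    calc _ = Ring.inverse (f α) * (Ring.inverse (1 + N * logDerivAt f α) *
            ((1 + N * logDerivAt f α) * N) - N) := by
          have e : T * -(Ring.inverse (f α) * logDerivAt f α) * -N
              = T * Ring.inverse (f α) * (logDerivAt f α * N) := by noncomm_ring
          rw [e, h3]
          noncomm_ring
      _ = 0 := by rw [← mul_assoc, Ring.inverse_mul_cancel _ hu, one_mul, sub_self, mul_zero]
  set K := dslope (dslope k α) α
  have hKc : Continuous K := (differentiable_dslope_dslope hkd α).continuous
  have hFc : Continuous (dressedLoop f α N) := (differentiable_dressedLoop hd).continuous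
  have nil : ∀ (c : ℂ) (m : 𝔸), m * m = 0 → (1 - c • m) * (1 + c • m) = 1 := by
    intro c m hm
    rw [sub_mul, mul_add, one_mul, one_mul, mul_add, mul_one, smul_mul_smul_comm, hm, smul_zero]
    abel
  have nil' : ∀ (c : ℂ) (m : 𝔸), m * m = 0 → (1 + c • m) * (1 - c • m) = 1 := by
    intro c m hm
    rw [add_mul, mul_sub, one_mul, one_mul, mul_sub, mul_one, smul_mul_smul_comm, hm, smul_zero]
    abel
  have hne : ∀ z ∈ ({α}ᶜ : Set ℂ), dressedLoop f α N z * K z = 1 ∧ K z * dressedLoop f α N z = 1 := by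
    intro z hz
    rw [dressedLoop_of_ne (hf α) hd hN hu hz, show K z = _ from dslope_dslope_of_ne hk0 hk1 hz,
      inv_smul_inv_smul_pole (sub_ne_zero.2 hz), ← hT]
    set c := (z - α)⁻¹
    constructor
    · calc _ = (1 + c • N) * f z * ((1 - c • T) * (1 + c • T)) * Ring.inverse (f z)
            * (1 - c • N) := by simp only [mul_assoc]
        _ = (1 + c • N) * (f z * Ring.inverse (f z)) * (1 - c • N) := by
          rw [nil c T hNt, mul_one, mul_assoc (1 + c • N)]
        _ = 1 := by rw [Ring.mul_inverse_cancel _ (hf z), mul_one, nil' c N hN]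
    · calc _ = (1 + c • T) * Ring.inverse (f z) * ((1 - c • N) * (1 + c • N)) * f z
            * (1 - c • T) := by simp only [mul_assoc]
        _ = (1 + c • T) * (Ring.inverse (f z) * f z) * (1 - c • T) := by
          rw [nil c N hN, mul_one, mul_assoc (1 + c • T)]
        _ = 1 := by rw [Ring.inverse_mul_cancel _ (hf z), mul_one, nil' c T hNt]
  have e1 := Continuous.ext_on (dense_compl_singleton α) (hFc.mul hKc) continuous_const
    (fun z hz => (hne z hz).1)
  have e2 := Continuous.ext_on (dense_compl_singleton α) (hKc.mul hFc) continuous_const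
    (fun z hz => (hne z hz).2)
  exact ⟨⟨_, K z, congrFun e1 z, congrFun e2 z⟩, rfl⟩

end Loop

end Complete

end LaxFrames

/-! ### Regularity by bootstrapping. -/

section Smoothness

variable {X 𝔸 F : Type*} [NormedAddCommGroup X] [NormedSpace ℝ X] [NormedRing 𝔸]
  [NormedAlgebra ℝ 𝔸] [NormedAddCommGroup F] [NormedSpace ℝ F]

theorem ContDiffOn.leftMul {k : ℕ∞ω} {V : Set X} {a : X → 𝔸} {L : X → X →L[ℝ] 𝔸}
    (ha : ContDiffOn ℝ k a V) (hL : ContDiffOn ℝ k L V) :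
    ContDiffOn ℝ k (fun x => leftMul (a x) (L x)) V :=
  ((ContinuousLinearMap.mul ℝ 𝔸).contDiff.comp_contDiffOn ha).clm_comp hL

theorem ContDiffOn.rightMul {k : ℕ∞ω} {V : Set X} {a : X → 𝔸} {L : X → X →L[ℝ] 𝔸}
    (hL : ContDiffOn ℝ k L V) (ha : ContDiffOn ℝ k a V) :
    ContDiffOn ℝ k (fun x => rightMul (L x) (a x)) V :=
  ((ContinuousLinearMap.mul ℝ 𝔸).flip.contDiff.comp_contDiffOn ha).clm_comp hL

/-- Bootstrapping: a solution of a first order equation whose right hand side is as regular as the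
solution is smooth. -/
theorem contDiffOn_infty_of_hasFDerivAt {V : Set X} (hV : IsOpen V) {Y : X → F}
    {Φ : X → X →L[ℝ] F} (hY : ∀ x ∈ V, HasFDerivAt Y (Φ x) x)
    (h : ∀ k : ℕ, ContDiffOn ℝ k Y V → ContDiffOn ℝ k Φ V) : ContDiffOn ℝ ∞ Y V := by
  rw [contDiffOn_infty]
  intro k
  induction k with
  | zero =>
    rw [Nat.cast_zero, contDiffOn_zero]
    exact fun x hx => (hY x hx).continuousAt.continuousWithinAt
  | succ k ih =>
    rw [Nat.cast_succ, contDiffOn_succ_iff_fderiv_of_isOpen hV]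
    refine ⟨fun x hx => (hY x hx).differentiableAt.differentiableWithinAt, by simp, ?_⟩
    exact (h k ih).congr fun x hx => (hY x hx).fderiv

end Smoothness

/-- Algebra-valued `1`-forms at a point. -/
abbrev AlgForm (X 𝔸 : Type*) [NormedAddCommGroup X] [NormedSpace ℝ X] [NormedRing 𝔸]
    [NormedAlgebra ℂ 𝔸] := X →L[ℝ] 𝔸

/-- `L` is the differential of the algebra-valued map `F` at `x`. -/
abbrev HasDifferential {X 𝔸 : Type*} [NormedAddCommGroup X] [NormedSpace ℝ X] [NormedRing 𝔸]
    [NormedAlgebra ℂ 𝔸] (F : X → 𝔸) (L : AlgForm X 𝔸) (x : X) : Prop := HasFDerivAt F L x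

/-- Smooth families of algebra-valued `1`-forms. -/
abbrev SmoothFormOn {X 𝔸 : Type*} [NormedAddCommGroup X] [NormedSpace ℝ X] [NormedRing 𝔸]
    [NormedAlgebra ℂ 𝔸] (A : X → AlgForm X 𝔸) (U : Set X) : Prop := ContDiffOn ℝ ∞ A U

theorem smoothFormOn_sum_smul {X 𝔸 ι : Type*} [NormedAddCommGroup X] [NormedSpace ℝ X]
    [NormedRing 𝔸] [NormedAlgebra ℂ 𝔸] [Fintype ι] {U : Set X} {b : ι → X → ℝ}
    (hb : ∀ i, ContDiffOn ℝ ∞ (b i) U) (C : ι → AlgForm X 𝔸) :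
    SmoothFormOn (fun x => ∑ i, b i x • C i) U :=
  ContDiffOn.sum fun i _ => (hb i).smul contDiffOn_const

/-! ### Dressing of Lax frames. -/

section LaxFrames

variable {X 𝔸 : Type*} [NormedAddCommGroup X] [NormedSpace ℝ X] [NormedRing 𝔸]
  [NormedAlgebra ℂ 𝔸]

/-- A family `F(x, z)` of invertible solutions of `dF = F (z δ + A)`, entire in `z`. -/
structure IsLaxFrame (V : Set X) (δ : X →L[ℝ] 𝔸) (A : X → X →L[ℝ] 𝔸) (F : X → ℂ → 𝔸) : Prop where
  isOpen : IsOpen V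
  contDiffOn : ContDiffOn ℝ ∞ A V
  isUnit : ∀ x ∈ V, ∀ z, IsUnit (F x z)
  differentiable : ∀ x ∈ V, Differentiable ℂ (F x)
  hasFDerivAt : ∀ x ∈ V, ∀ z, HasFDerivAt (fun y => F y z) (leftMul (F x z) (z • δ + A x)) x

namespace IsLaxFrame

variable {V : Set X} {δ : X →L[ℝ] 𝔸} {A : X → X →L[ℝ] 𝔸} {F : X → ℂ → 𝔸}

theorem contDiffOn_frame (h : IsLaxFrame V δ A F) (z : ℂ) :
    ContDiffOn ℝ ∞ (fun x => F x z) V := by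
  refine contDiffOn_infty_of_hasFDerivAt h.isOpen (fun x hx => h.hasFDerivAt x hx z) fun k hk => ?_
  exact hk.leftMul (contDiffOn_const.add (h.contDiffOn.of_le (mod_cast le_top)))

variable [CompleteSpace 𝔸]

theorem hasFDerivAt_logDerivAt (h : IsLaxFrame V δ A F) (α : ℂ) {x : X} (hx : x ∈ V) :
    HasFDerivAt (fun y => logDerivAt (F y) α)
      (leftMul (F x α) (rightMul δ (Ring.inverse (F x α)))) x := by
  obtain ⟨r, hr, -, hloc⟩ := exists_local_hasDerivAt h.isOpen h.contDiffOn.continuousOn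
    h.hasFDerivAt h.isUnit α hx
  obtain ⟨q, hq⟩ := hloc x (Metric.mem_ball_self hr) (h.differentiable x hx α)
  refine (hq x (Metric.mem_ball_self hr)).2.congr_of_eventuallyEq ?_
  filter_upwards [Metric.ball_mem_nhds x hr] with y hy using (hq y hy).1.deriv

theorem isOpen_setOf_isUnit (h : IsLaxFrame V δ A F) (α : ℂ) (N : 𝔸) :
    IsOpen {x ∈ V | IsUnit (1 + N * logDerivAt (F x) α)} := by
  have hc : ContinuousOn (fun x => 1 + N * logDerivAt (F x) α) V := fun x hx =>
    (continuousAt_const.add (continuousAt_const.mul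
      (h.hasFDerivAt_logDerivAt α hx).continuousAt)).continuousWithinAt
  exact hc.isOpen_inter_preimage h.isOpen Units.isOpen

/-- A Riccati equation. Since `df₁ = f δ f⁻¹` with `f = F(x, α)`, the differential of `R N` is `-R N
f δ f⁻¹ R N`, which becomes `-Ñ δ Ñ` after conjugation by `f`; differentiating the conjugation
itself gives the commutator of `Ñ` with `α δ + A`. -/
theorem hasFDerivAt_dressedNil (h : IsLaxFrame V δ A F) {α : ℂ} {N : 𝔸} {x : X} (hx : x ∈ V)
    (hu : IsUnit (1 + N * logDerivAt (F x) α)) :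
    HasFDerivAt (fun y => dressedNil (F y) α N)
      (leftMul (dressedNil (F x) α N) (α • δ + A x) - rightMul (α • δ + A x) (dressedNil (F x) α N)
        - leftMul (dressedNil (F x) α N) (rightMul δ (dressedNil (F x) α N))) x := by
  have h1 := h.hasFDerivAt_logDerivAt α hx
  have h2 := (((hasFDerivAt_const N x).mul_leftMul h1).const_add 1)
  obtain ⟨u, hu'⟩ := id hu
  have h3 := hasFDerivAt_ringInverse (𝕜 := ℝ) u
  rw [hu'] at h3
  have h4 := (h3.comp x h2).mul_leftMul (hasFDerivAt_const N x)
  have h5 := (((h.hasFDerivAt x hx α).ringInverse_of_linear (h.isUnit x hx α)).mul_leftMul h4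
    ).mul_leftMul (h.hasFDerivAt x hx α)
  refine h5.congr_fderiv ?_
  generalize α • δ + A x = L
  ext v
  have hinv : (↑u⁻¹ : 𝔸) = Ring.inverse (1 + N * logDerivAt (F x) α) := by simp [← hu']
  simp only [add_apply, sub_apply, neg_apply, leftMul_apply, rightMul_apply, dressedNil,
    Function.comp_apply, ContinuousLinearMap.comp_apply, zero_apply, mul_zero, zero_mul, add_zero,
    zero_add, ContinuousLinearMap.mulLeftRight_apply, hinv]
  generalize L v = Ω
  have hF := Ring.mul_inverse_cancel _ (h.isUnit x hx α)
  generalize F x α = f at hF ⊢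
  generalize Ring.inverse f = g at hF ⊢
  generalize Ring.inverse (1 + N * logDerivAt _ α) = R
  generalize δ v = d
  have e1 : g * (R * N) * f * (d * (g * (R * N) * f)) = g * (R * N) * (f * d * g) * (R * N) * f := by
    noncomm_ring
  have e2 : g * (R * N) * f * Ω = g * (R * N) * (f * Ω) := by noncomm_ring
  rw [e1, e2]
  noncomm_ring

/-- The potential of the dressed frame. -/
noncomputable def _root_.dressedPotential (δ : X →L[ℝ] 𝔸) (A : X → X →L[ℝ] 𝔸) (T : X → 𝔸) (x : X) :
    X →L[ℝ] 𝔸 :=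
  A x - (rightMul δ (T x) - leftMul (T x) δ)

/-- The right-hand side of the Riccati equation is polynomial in `Ñ`, so bootstrapping applies
without any study of higher derivatives of `f₁`. -/
theorem contDiffOn_dressedNil (h : IsLaxFrame V δ A F) {α : ℂ} {N : 𝔸} :
    ContDiffOn ℝ ∞ (fun y => dressedNil (F y) α N)
      {x ∈ V | IsUnit (1 + N * logDerivAt (F x) α)} := by
  refine contDiffOn_infty_of_hasFDerivAt (h.isOpen_setOf_isUnit α N)
    (fun x hx => h.hasFDerivAt_dressedNil hx.1 hx.2) fun k hk => ?_
  have hΩ : ContDiffOn ℝ k (fun x => α • δ + A x) {x ∈ V | IsUnit (1 + N * logDerivAt (F x) α)} :=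
    contDiffOn_const.add ((h.contDiffOn.of_le (mod_cast le_top)).mono fun x hx => hx.1)
  exact ((hk.leftMul hΩ).sub (hΩ.rightMul hk)).sub (hk.leftMul (contDiffOn_const.rightMul hk))

theorem hasFDerivAt_dressedLoop_of_ne (h : IsLaxFrame V δ A F) {α : ℂ} {N : 𝔸} (hN : N * N = 0)
    {x : X} (hx : x ∈ V) (hu : IsUnit (1 + N * logDerivAt (F x) α)) {z : ℂ} (hz : z ≠ α) :
    HasFDerivAt (fun y => dressedLoop (F y) α N z)
      (leftMul (dressedLoop (F x) α N z)
        (z • δ + dressedPotential δ A (fun y => dressedNil (F y) α N) x)) x := by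
  have hw : z - α ≠ 0 := sub_ne_zero.2 hz
  have hT := dressedNil_mul_self (h.isUnit x hx α) hN hu
  have h1 := ((hasFDerivAt_const (1 + (z - α)⁻¹ • N) x).mul_leftMul
    (h.hasFDerivAt x hx z)).mul_leftMul
    (((h.hasFDerivAt_dressedNil hx hu).const_smul (z - α)⁻¹).const_sub 1)
  have hev : (fun y => dressedLoop (F y) α N z) =ᶠ[𝓝 x] fun y =>
      (1 + (z - α)⁻¹ • N) * F y z * (1 - (z - α)⁻¹ • dressedNil (F y) α N) := by
    filter_upwards [(h.isOpen_setOf_isUnit α N).mem_nhds ⟨hx, hu⟩] with y hy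
    exact dressedLoop_of_ne (h.isUnit y hy.1 α) (h.differentiable y hy.1) hN hy.2 hz
  rw [dressedLoop_of_ne (h.isUnit x hx α) (h.differentiable x hx) hN hu hz]
  refine (h1.congr_of_eventuallyEq hev).congr_fderiv ?_
  ext v
  simp only [add_apply, sub_apply, neg_apply, leftMul_apply, rightMul_apply, smul_apply,
    Pi.smul_apply, zero_apply, zero_mul, dressedPotential]
  generalize F x z = f
  generalize dressedNil (F x) α N = T at hT ⊢
  generalize A x v = a
  generalize δ v = d
  -- The gauge transformation of the potential by `1 - T/(z - α)`. Writing `z = (z - α) + α` and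
  -- using `T² = 0`, it is exactly the Riccati equation that removes the pole.
  have key : (1 - (z - α)⁻¹ • T) * (z • d + (a - (d * T - T * d)))
      = (z • d + a) * (1 - (z - α)⁻¹ • T)
        + -((z - α)⁻¹ • (T * (α • d + a) - (α • d + a) * T - T * (d * T))) := by
    have e : z • d = (z - α) • d + α • d := by rw [← add_smul, sub_add_cancel]
    have hT' : ∀ b, T * (T * b) = 0 := fun b => by rw [← mul_assoc, hT, zero_mul]
    rw [e]
    simp only [mul_add, add_mul, mul_sub, sub_mul, one_mul, mul_one, smul_mul_assoc,
      mul_smul_comm, smul_sub, smul_add, smul_smul, inv_mul_cancel₀ hw, mul_inv_cancel₀ hw,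
      one_smul, hT', smul_zero, neg_sub]
    rw [mul_comm α]
    abel
  rw [mul_assoc _ _ (z • d + _), key]
  noncomm_ring

/-- Dressing a frame with the simple element `1 + (z - α)⁻¹ N`. -/
theorem dress (h : IsLaxFrame V δ A F) {α : ℂ} {N : 𝔸} (hN : N * N = 0) :
    IsLaxFrame {x ∈ V | IsUnit (1 + N * logDerivAt (F x) α)} δ
      (dressedPotential δ A fun y => dressedNil (F y) α N) (fun x => dressedLoop (F x) α N) := by
  have hs : ContDiffOn ℝ ∞ (dressedPotential δ A fun y => dressedNil (F y) α N)
      {x ∈ V | IsUnit (1 + N * logDerivAt (F x) α)} :=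
    (h.contDiffOn.mono fun x hx => hx.1).sub
      ((contDiffOn_const.rightMul h.contDiffOn_dressedNil).sub
        (h.contDiffOn_dressedNil.leftMul contDiffOn_const))
  have hd : ∀ x ∈ {x ∈ V | IsUnit (1 + N * logDerivAt (F x) α)},
      Differentiable ℂ (dressedLoop (F x) α N) := fun x hx =>
    differentiable_dressedLoop (h.differentiable x hx.1)
  refine ⟨h.isOpen_setOf_isUnit α N, hs, fun x hx => isUnit_dressedLoop (h.isUnit x hx.1)
    (h.differentiable x hx.1) hN hx.2, hd, fun x hx z => ?_⟩
  by_cases hz : z = α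
  · subst hz
    -- At the pole no product formula is available; the equation there is the limit of the equations
    -- at nearby parameters.
    obtain ⟨r, hr, hsub, h1, M, hM, hb⟩ := exists_ball_norm_le (h.isOpen_setOf_isUnit z N)
      hs.continuousOn hs.continuousOn hx
    refine hasFDerivAt_of_tendsto_linear (l := 𝓝[≠] z) (Y := fun w y => dressedLoop (F y) z N w)
      (convex_ball x r) Metric.isOpen_ball hM (fun y hy => (hb y hy).1) nhdsWithin_le_nhds ?_
      (fun y hy => ((hd y (hsub hy)).continuous.tendsto z).mono_left nhdsWithin_le_nhds)
      (Metric.mem_ball_self hr) (fun y hy => h1 y hy x (Metric.mem_ball_self hr))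
      (Metric.mem_ball_self hr)
    filter_upwards [self_mem_nhdsWithin] with w hw y hy
    exact h.hasFDerivAt_dressedLoop_of_ne hN (hsub hy).1 (hsub hy).2 hw
  · exact h.hasFDerivAt_dressedLoop_of_ne hN hx.1 hx.2 hz

omit [CompleteSpace 𝔸] in
theorem congr_potential (h : IsLaxFrame V δ A F) {B : X → X →L[ℝ] 𝔸} (hAB : ∀ x ∈ V, A x = B x) :
    IsLaxFrame V δ B F where
  isOpen := h.isOpen
  contDiffOn := h.contDiffOn.congr fun x hx => (hAB x hx).symm
  isUnit := h.isUnit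
  differentiable := h.differentiable
  hasFDerivAt x hx z := by rw [← hAB x hx]; exact h.hasFDerivAt x hx z

omit [CompleteSpace 𝔸] in
/-- The potential of a frame is a flat connection. -/
theorem curvature_eq_zero (h : IsLaxFrame V δ A F) {x : X} (hx : x ∈ V) {v w : X}
    {Lv Lw : AlgForm X 𝔸} (hv : HasDifferential (fun y => A y v) Lv x)
    (hw : HasDifferential (fun y => A y w) Lw x) :
    Lw v - Lv w = A x w * A x v - A x v * A x w := by
  -- At `z = 0` the `δ`-term drops out, and flatness of `A` is the symmetry of the second derivative
  -- of `F(·, 0)`.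
  set Φ : X → X →L[ℝ] 𝔸 := fun y => leftMul (F y 0) ((0 : ℂ) • δ + A y)
  have hΦ : HasFDerivAt Φ (fderiv ℝ Φ x) x :=
    ((((h.contDiffOn_frame 0).leftMul (contDiffOn_const.add h.contDiffOn)).contDiffAt
      (h.isOpen.mem_nhds hx)).differentiableAt (by simp)).hasFDerivAt
  have hsymm := second_derivative_symmetric_of_eventually_of_real
    (f := fun y => F y 0) (f' := Φ) (x := x)
    (by filter_upwards [h.isOpen.mem_nhds hx] with y hy using h.hasFDerivAt y hy 0) hΦ v w
  have key : ∀ {a b : X} {L : AlgForm X 𝔸}, HasDifferential (fun y => A y a) L x →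
      fderiv ℝ Φ x b a = F x 0 * L b + F x 0 * A x b * A x a := by
    intro a b L hL
    have h1 : HasFDerivAt (fun y => Φ y a) ((fderiv ℝ Φ x).flip a) x := by
      refine (hΦ.clm_apply (hasFDerivAt_const a x)).congr_fderiv ?_
      ext c
      simp
    have h2 : HasFDerivAt (fun y => Φ y a) _ x :=
      ((h.hasFDerivAt x hx 0).mul_leftMul hL).congr_of_eventuallyEq
        (Eventually.of_forall fun y => by simp [Φ])
    have h3 := congrArg (fun M : X →L[ℝ] 𝔸 => M b) (h1.unique h2)
    simpa using h3
  rw [key hw, key hv] at hsymm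
  have h4 : F x 0 * (Lw v - Lv w) = F x 0 * (A x w * A x v - A x v * A x w) := by
    rw [mul_sub, mul_sub, ← mul_assoc, ← mul_assoc]
    rw [sub_eq_sub_iff_add_eq_add]
    exact hsymm.trans (add_comm _ _)
  exact (h.isUnit x hx 0).mul_left_cancel h4

end IsLaxFrame

end LaxFrames

open NilpotentDressing

-- Matrices as a Banach algebra, and entrywise calculus.

attribute [local instance] Matrix.linftyOpNormedRing Matrix.linftyOpNormedAlgebra


section Entries

variable {n : ℕ}

theorem matrix_eq_sum_smul_single (A : CMat n) :
    A = ∑ p, ∑ q, A p q • Matrix.single p q (1 : ℂ) := by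
  conv_lhs => rw [Matrix.matrix_eq_sum_single A]
  simp [Matrix.smul_single]

variable {𝕜 W : Type*} [NontriviallyNormedField 𝕜] [NormedAlgebra 𝕜 ℂ] [NormedAddCommGroup W]
  [NormedSpace 𝕜 W]

/-- The `(p, q)` entry as a continuous linear functional. -/
noncomputable def entryCLM (𝕜 : Type*) [NontriviallyNormedField 𝕜] [NormedAlgebra 𝕜 ℂ]
    (p q : Fin n) : CMat n →L[𝕜] ℂ :=
  ⟨Matrix.entryLinearMap 𝕜 ℂ p q, continuous_id.matrix_elem p q⟩

@[simp] theorem entryCLM_apply (p q : Fin n) (A : CMat n) : entryCLM 𝕜 p q A = A p q := rfl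

theorem differentiableAt_entries_iff {f : W → CMat n} {x : W} :
    DifferentiableAt 𝕜 f x ↔ ∀ p q, DifferentiableAt 𝕜 (fun y => f y p q) x := by
  refine ⟨fun h p q => (entryCLM 𝕜 p q).differentiableAt.comp x h, fun h => ?_⟩
  have e : f = fun y => ∑ p, ∑ q, f y p q • Matrix.single p q (1 : ℂ) :=
    funext fun y => matrix_eq_sum_smul_single (f y)
  rw [e]
  exact DifferentiableAt.fun_sum fun p _ => DifferentiableAt.fun_sum fun q _ =>
    (h p q).smul_const _

theorem contDiffOn_entries {f : W → CMat n} {s : Set W} {k : ℕ∞ω} (h : ContDiffOn 𝕜 k f s)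
    (p q : Fin n) : ContDiffOn 𝕜 k (fun y => f y p q) s :=
  (entryCLM 𝕜 p q).contDiff.comp_contDiffOn h

theorem continuous_entries {Z : Type*} [TopologicalSpace Z] {f : Z → CMat n} (h : Continuous f)
    (p q : Fin n) : Continuous fun z => f z p q :=
  (entryCLM ℂ p q).continuous.comp h

end Entries

/-! ### From frames and loops of matrices to Lax frames and back. -/

section Bridge

variable {n : ℕ}

theorem form_ext {L L' : AlgForm (Pt n) (CMat n)}
    (h : ∀ i, L (Pi.single i 1) = L' (Pi.single i 1)) : L = L' := by
  refine ContinuousLinearMap.ext fun v => ?_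
  have e : v = ∑ i, v i • (Pi.single i 1 : Pt n) := by
    ext j
    simp [Finset.sum_apply, Pi.single_apply]
  rw [e]
  simp only [map_sum, map_smul, h]

theorem hasFDerivAt_matrix_iff {F : Pt n → CMat n} {L : AlgForm (Pt n) (CMat n)} {x : Pt n} :
    HasDifferential F L x ↔ (∀ p q, DifferentiableAt ℝ (fun y => F y p q) x) ∧
      ∀ i, pderiv i F x = L (Pi.single i 1) := by
  have h1 : ∀ {L : AlgForm (Pt n) (CMat n)}, HasDifferential F L x →
      ∀ i, pderiv i F x = L (Pi.single i 1) := by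
    intro L h i
    ext p q
    have := ((entryCLM ℝ p q).hasFDerivAt.comp x h).fderiv
    simp only [pderiv, Matrix.of_apply]
    erw [this]
    rfl
  refine ⟨fun h => ⟨differentiableAt_entries_iff.1 h.differentiableAt, h1 h⟩, fun h => ?_⟩
  have h2 := (differentiableAt_entries_iff.2 h.1).hasFDerivAt
  rwa [form_ext fun i => (h.2 i).symm.trans (h1 h2 i)]

/-- The matrix-valued `1`-form `∑ i, B i dx_i`. -/
noncomputable def formOf (B : Fin n → CMat n) : AlgForm (Pt n) (CMat n) :=
  ∑ i, (ContinuousLinearMap.proj (R := ℝ) (φ := fun _ : Fin n => ℝ) i).smulRight (B i)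

theorem formOf_apply (B : Fin n → CMat n) (v : Pt n) : formOf B v = ∑ i, v i • B i := by
  simp [formOf]

@[simp] theorem formOf_single (B : Fin n → CMat n) (i : Fin n) :
    formOf B (Pi.single i 1) = B i := by
  rw [formOf_apply, Finset.sum_eq_single i (fun j _ hj => by simp [Pi.single_eq_of_ne hj])
    (by simp), Pi.single_eq_same, one_smul]

/-- The `1`-form `∑ i, a_i dx_i`. -/
noncomputable def diagForm (n : ℕ) : AlgForm (Pt n) (CMat n) := formOf fun i => toC (diagUnit i)

/-- The `1`-form `∑ i, [a_i, β(x)] dx_i`. -/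
noncomputable def potential (β : Pt n → RMat n) (x : Pt n) : AlgForm (Pt n) (CMat n) :=
  formOf fun i => toC ⁅diagUnit i, β x⁆

@[simp] theorem toC_apply (A : RMat n) (p q : Fin n) : toC A p q = (A p q : ℂ) := rfl

theorem toC_mul (A B : RMat n) : toC (A * B) = toC A * toC B :=
  Matrix.map_mul (f := Complex.ofRealHom)

theorem toC_sub (A B : RMat n) : toC (A - B) = toC A - toC B := by
  ext; simp

theorem toC_injective : Function.Injective (toC (n := n)) :=
  Matrix.map_injective Complex.ofReal_injective

theorem toC_transpose (A : RMat n) : (toC A).transpose = toC A.transpose := rfl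

theorem lie_diagUnit_apply (i : Fin n) (B : RMat n) (p q : Fin n) :
    ⁅diagUnit i, B⁆ p q = ((if i = p then 1 else 0) - (if i = q then 1 else 0)) * B p q := by
  rw [Ring.lie_def, Matrix.sub_apply, diagUnit, sub_mul]
  congr 1
  · by_cases h : i = p
    · subst h; simp
    · simp [h, Matrix.single_mul_apply_of_ne _ _ _ _ _ (Ne.symm h)]
  · by_cases h : i = q
    · subst h; simp
    · simp [h, Matrix.mul_single_apply_of_ne _ _ _ _ _ (Ne.symm h)]

theorem contDiffOn_potential {U : Set (Pt n)} {β : Pt n → RMat n} (hβ : ∀ p q,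
    ContDiffOn ℝ ∞ (fun x => β x p q) U) : SmoothFormOn (potential β) U := by
  have e : potential β = fun x => ∑ r : Fin n × Fin n, β x r.1 r.2 • formOf fun i =>
      toC ⁅diagUnit i, Matrix.single r.1 r.2 (1 : ℝ)⁆ := by
    funext x
    refine form_ext fun i => ?_
    simp only [potential, formOf_single, sum_apply, smul_apply]
    ext a b
    simp only [Matrix.sum_apply, Matrix.smul_apply, toC_apply, lie_diagUnit_apply,
      Matrix.single_apply]
    rw [Finset.sum_eq_single (a, b)]
    · simp; ring
    · rintro ⟨c, d⟩ - hcd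
      have : ¬ (c = a ∧ d = b) := fun h => hcd (by rw [h.1, h.2])
      simp [this]
    · simp
  rw [e]
  exact smoothFormOn_sum_smul (fun r : Fin n × Fin n => hβ r.1 r.2) _

theorem NilpotentDressing.IsFrame.hasFDerivAt {U : Set (Pt n)} {β : Pt n → RMat n}
    {E : Pt n → ℂ → CMat n} (hE : IsFrame U β E) (hU : IsOpen U) {x : Pt n} (hx : x ∈ U) (z : ℂ) :
    HasDifferential (fun y => E y z) (leftMul (E x z) (z • diagForm n + potential β x)) x := by
  refine hasFDerivAt_matrix_iff.2 ⟨fun p q => (hE.differentiable z p q).differentiableAt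
    (hU.mem_nhds hx), fun i => ?_⟩
  have h := hE.eqn z x hx i
  have hu := (Matrix.isUnit_iff_isUnit_det _).1 (hE.isUnit z x hx)
  simp only [leftMul_apply, add_apply, smul_apply, diagForm, potential, formOf_single]
  rw [← h, Matrix.mul_nonsing_inv_cancel_left _ _ hu]

/-- The point is holomorphy in `z`, which starts from `E(0, z) = 1` and spreads over the connected
set `U`. -/
theorem NilpotentDressing.IsFrame.isLaxFrame {U : Set (Pt n)} {β : Pt n → RMat n}
    {E : Pt n → ℂ → CMat n} (hE : IsFrame U β E) (hβ : IsSolution U β) (hU : IsOpen U)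
    (hUc : IsPreconnected U) (h0 : (0 : Pt n) ∈ U) :
    IsLaxFrame U (diagForm n) (potential β) E where
  isOpen := hU
  contDiffOn := contDiffOn_potential hβ.smooth
  isUnit x hx z := hE.isUnit z x hx
  differentiable x hx := differentiable_of_linear hU hUc
    (contDiffOn_potential hβ.smooth).continuousOn (fun x hx z => hE.hasFDerivAt hU hx z)
    (fun x hx z => hE.isUnit z x hx) h0 (by
      rw [show E 0 = fun _ => 1 from funext fun z => hE.init z]
      exact differentiable_const _) hx
  hasFDerivAt x hx z := hE.hasFDerivAt hU hx z

theorem isFrame_of_isLaxFrame {V : Set (Pt n)} {β : Pt n → RMat n} {A : Pt n → AlgForm (Pt n) (CMat n)}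
    {F : Pt n → ℂ → CMat n} (hF : IsLaxFrame V (diagForm n) A F)
    (hA : ∀ x ∈ V, A x = potential β x) (h0 : ∀ z, F 0 z = 1) : IsFrame V β F where
  differentiable z p q x hx := ((hasFDerivAt_matrix_iff.1
    (hF.hasFDerivAt x hx z)).1 p q).differentiableWithinAt
  isUnit z x hx := hF.isUnit x hx z
  eqn z x hx i := by
    have hu := (Matrix.isUnit_iff_isUnit_det _).1 (hF.isUnit x hx z)
    rw [(hasFDerivAt_matrix_iff.1 (hF.hasFDerivAt x hx z)).2 i, hA x hx]
    simp only [leftMul_apply, add_apply, smul_apply, diagForm, potential, formOf_single]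
    rw [Matrix.nonsing_inv_mul_cancel_left _ _ hu]
  init := h0

theorem logCoeff_eq {f : ℂ → CMat n} {α : ℂ} (hf : DifferentiableAt ℂ f α) :
    logCoeff f α = logDerivAt f α := by
  ext p q
  have h := (entryCLM ℂ p q).hasFDerivAt.comp_hasDerivAt α
    ((hf.mul_const (Ring.inverse (f α))).hasDerivAt)
  simp only [logCoeff, Matrix.of_apply, Matrix.nonsing_inv_eq_ringInverse]
  exact h.deriv

theorem logCoeff_congr {f g : ℂ → CMat n} {α : ℂ} (h : f =ᶠ[𝓝 α] g) :
    logCoeff f α = logCoeff g α := by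
  ext p q
  simp only [logCoeff, Matrix.of_apply]
  refine Filter.EventuallyEq.deriv_eq ?_
  filter_upwards [h] with z hz
  rw [hz, h.self_of_nhds]

theorem dressN_eq {f : ℂ → CMat n} {α : ℂ} (hf : DifferentiableAt ℂ f α) (N : CMat n) :
    dressN f α N = dressedNil f α N := by
  simp only [dressN, dressedNil, logCoeff_eq hf, Matrix.nonsing_inv_eq_ringInverse, mul_assoc]

theorem one_add_smul_mul_one_sub_smul {N : CMat n} (hN : N * N = 0) (c : ℂ) :
    (1 + c • N) * (1 - c • N) = 1 := by
  rw [add_mul, mul_sub, one_mul, one_mul, mul_sub, mul_one, smul_mul_smul_comm, hN, smul_zero]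
  abel

theorem mElt_inv {N : CMat n} (hN : N * N = 0) (α z : ℂ) :
    (mElt α N z)⁻¹ = 1 - (z - α)⁻¹ • N :=
  Matrix.inv_eq_right_inv (one_add_smul_mul_one_sub_smul hN _)

section OneLoop

variable {f : ℂ → CMat n} {α : ℂ} {N : CMat n}

theorem wellDefined_iff (hd : Differentiable ℂ f) :
    WellDefined f α N ↔ IsUnit (1 + N * logDerivAt f α) := by
  rw [WellDefined, logCoeff_eq (hd α)]

theorem dressLoop_of_ne (hf : ∀ z, IsUnit (f z)) (hd : Differentiable ℂ f) (hN : N * N = 0)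
    (hu : IsUnit (1 + N * logDerivAt f α)) {z : ℂ} (hz : z ≠ α) :
    dressLoop f α N z = dressedLoop f α N z := by
  rw [dressedLoop_of_ne (hf α) hd hN hu hz, dressLoop, dressN_eq (hd α),
    mElt_inv (dressedNil_mul_self (hf α) hN hu), mElt]

/-- The value of `dressLoop` at `α` is an artefact of `0⁻¹ = 0`. The second dressing step involves
only the germ at `-α ≠ α`, where it agrees with the entire extension. -/
theorem dressLoop_eventuallyEq (hf : ∀ z, IsUnit (f z)) (hd : Differentiable ℂ f) (hN : N * N = 0)
    (hu : IsUnit (1 + N * logDerivAt f α)) {z : ℂ} (hz : z ≠ α) :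
    dressLoop f α N =ᶠ[𝓝 z] dressedLoop f α N := by
  filter_upwards [isOpen_ne.mem_nhds hz] with w hw using dressLoop_of_ne hf hd hN hu hw

theorem wellDefined_dressLoop_iff (hf : ∀ z, IsUnit (f z)) (hd : Differentiable ℂ f)
    (hN : N * N = 0) (hu : IsUnit (1 + N * logDerivAt f α)) {z : ℂ} (hz : z ≠ α) (N' : CMat n) :
    WellDefined (dressLoop f α N) z N' ↔
      IsUnit (1 + N' * logDerivAt (dressedLoop f α N) z) := by
  rw [WellDefined, logCoeff_congr (dressLoop_eventuallyEq hf hd hN hu hz),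
    logCoeff_eq (differentiable_dressedLoop hd z)]

theorem dressN_dressLoop_eq (hf : ∀ z, IsUnit (f z)) (hd : Differentiable ℂ f)
    (hN : N * N = 0) (hu : IsUnit (1 + N * logDerivAt f α)) {z : ℂ} (hz : z ≠ α) (N' : CMat n) :
    dressN (dressLoop f α N) z N' = dressedNil (dressedLoop f α N) z N' := by
  rw [← dressN_eq (differentiable_dressedLoop hd z), dressN, dressN,
    logCoeff_congr (dressLoop_eventuallyEq hf hd hN hu hz), dressLoop_of_ne hf hd hN hu hz]

theorem logDerivAt_one : logDerivAt (fun _ : ℂ => (1 : CMat n)) α = 0 := by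
  simp [logDerivAt]

theorem dressedNil_one : dressedNil (fun _ : ℂ => (1 : CMat n)) α N = N := by
  simp [dressedNil, logDerivAt_one]

/-- Applied at the base point `x = 0`: there `f₁ = 0` and `Ñ = N`, the two factors cancel, and the
normalisation of the frame persists. -/
theorem dressedLoop_one (hN : N * N = 0) :
    dressedLoop (fun _ : ℂ => (1 : CMat n)) α N = fun _ => 1 := by
  have hd : Differentiable ℂ (fun _ : ℂ => (1 : CMat n)) := differentiable_const _
  refine Continuous.ext_on (dense_compl_singleton α) (differentiable_dressedLoop hd).continuous
    continuous_const fun z hz => ?_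
  rw [dressedLoop_of_ne isUnit_one hd hN (by simp [logDerivAt_one]) hz, dressedNil_one, mul_one,
    one_add_smul_mul_one_sub_smul hN]

end OneLoop

end Bridge

/-! ### Algebra of the twisted simple element. -/

section TwistAlgebra

variable {A : Type*} [Ring A] {n m R : A}

/-- In the application `n = N/(2α)`, `m = Nᵗ/(2α)` and `R = (1 + mn)⁻¹`, so that `(1 - n) R m (1 +
n)` is `N'/(2α)`. It squares to zero because `m R = m` and `(1 + n)(1 - n) = 1`. -/
theorem twist_mul_self (hn : n * n = 0) (hm : m * m = 0) (hR : (1 + m * n) * R = 1) :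
    ((1 - n) * R * m * (1 + n)) * ((1 - n) * R * m * (1 + n)) = 0 := by
  have h1 : m * R = m := by
    calc m * R = m * (1 + m * n) * R - (m * m) * n * R := by noncomm_ring
      _ = m := by rw [mul_assoc m, hR, hm]; simp
  have h2 : (1 + n) * (1 - n) = 1 := by
    calc (1 + n) * (1 - n) = 1 - n * n := by noncomm_ring
      _ = 1 := by rw [hn, sub_zero]
  calc _ = (1 - n) * R * m * ((1 + n) * (1 - n)) * R * m * (1 + n) := by noncomm_ring
    _ = (1 - n) * R * ((m * R) * m) * (1 + n) := by rw [h2]; noncomm_ring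
    _ = 0 := by rw [h1, hm]; simp

/-- This identity and the next equate the residues, divided by `2α`, of `s(z)` and of the inverse of
`s(-z)ᵗ` at `-α` and at `α`. The factor `(1 + m) n R (1 - m)` is the transpose of `(1 - n) R m (1 +
n)`. -/
theorem twist_residue_neg (hn : n * n = 0) (hm : m * m = 0) (hR : (1 + m * n) * R = 1) :
    (1 - n) * R * m * (1 + n) - (1 - n) * R * m * (1 + n) * n
      = m - (1 + m) * n * R * (1 - m) * m := by
  have h1 : m * n * R = 1 - R := by rw [← hR]; noncomm_ring
  calc _ = (1 - n) * R * m * (1 - n * n) := by noncomm_ring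
    _ = (1 - n) * R * m := by rw [hn, sub_zero, mul_one]
    _ = m - n * R * m - (1 - R) * m := by noncomm_ring
    _ = m - (1 + m) * n * R * m := by rw [← h1]; noncomm_ring
    _ = m - (1 + m) * n * R * (m - m * m) := by rw [hm, sub_zero]
    _ = _ := by noncomm_ring

theorem twist_residue_pos (hn : n * n = 0) (hm : m * m = 0) (hR : (1 + m * n) * R = 1)
    (hR' : R * (1 + m * n) = 1) :
    n + (1 - n) * R * m * (1 + n) * n
      = (1 + m) * n * R * (1 - m) + (1 + m) * n * R * (1 - m) * m := by
  have h1 : m * n * R = 1 - R := by rw [← hR]; noncomm_ring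
  have h2 : R * m * n = 1 - R := by rw [← hR']; noncomm_ring
  calc _ = n + (1 - n) * (R * m * n) + (1 - n) * R * m * (n * n) := by noncomm_ring
    _ = n + (1 - n) * (1 - R) := by rw [hn, h2]; simp
    _ = n * R + (1 - R) := by noncomm_ring
    _ = (1 + m) * n * R * (1 - m * m) := by rw [← h1, hm]; noncomm_ring
    _ = _ := by noncomm_ring

end TwistAlgebra

section Twist

variable {n : ℕ}

/-- Reality of `N` and `α` enters here: `NᵗN` is positive semidefinite, so `N'` exists with no
smallness condition on `N`. -/
theorem isUnit_one_add_transpose_mul_self {α : ℝ} (hα : α ≠ 0) (N : RMat n) :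
    IsUnit (1 + (4 * α ^ 2)⁻¹ • (N.transpose * N)) := by
  have h1 : (N.transpose * N).PosSemidef := by
    simpa using Matrix.posSemidef_conjTranspose_mul_self N
  have h2 : (1 + (4 * α ^ 2)⁻¹ • (N.transpose * N)).PosDef :=
    Matrix.PosDef.one.add_posSemidef (h1.smul (by positivity))
  exact h2.isUnit

/-- The real form of `twistN`. -/
theorem exists_twistN_eq_toC {α : ℝ} (hα : α ≠ 0) {N : RMat n} (hN : N * N = 0) :
    ∃ N' : RMat n, toC N' = twistN α (toC N) ∧ N' * N' = 0 ∧
      ∀ u w : ℂ, 2 * α * (u * w) = u - w →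
        (1 + w • toC N') * (1 + u • toC N)
          = (1 + u • (toC N').transpose) * (1 + w • (toC N).transpose) := by
  set c : ℝ := (2 * α)⁻¹ with hc
  have hc0 : c ≠ 0 := by rw [hc]; simpa using hα
  have hcc : (4 * α ^ 2)⁻¹ = c * c := by rw [hc]; field_simp; norm_num
  set ν : RMat n := c • N with hν
  set μ : RMat n := c • N.transpose with hμ
  have hN' : N.transpose * N.transpose = 0 := by rw [← Matrix.transpose_mul, hN]; simp
  have hνν : ν * ν = 0 := by simp [hν, hN]
  have hμμ : μ * μ = 0 := by simp [hμ, hN']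
  have hμν : μ * ν = (4 * α ^ 2)⁻¹ • (N.transpose * N) := by
    rw [hμ, hν, smul_mul_smul_comm, hcc]
  have hu := (Matrix.isUnit_iff_isUnit_det _).1 (isUnit_one_add_transpose_mul_self hα N)
  rw [← hμν] at hu
  set R : RMat n := (1 + μ * ν)⁻¹ with hRdef
  have hR : (1 + μ * ν) * R = 1 := Matrix.mul_nonsing_inv _ hu
  have hR' : R * (1 + μ * ν) = 1 := Matrix.nonsing_inv_mul _ hu
  have hμt : μ.transpose = ν := by simp [hμ, hν]
  have hνt : ν.transpose = μ := by simp [hμ, hν]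
  have hRt : R.transpose = R := by
    rw [hRdef, Matrix.transpose_nonsing_inv]
    simp [Matrix.transpose_mul, hμt, hνt]
  set ξ : RMat n := (1 - ν) * R * μ * (1 + ν) with hξ
  have hξt : ξ.transpose = (1 + μ) * ν * R * (1 - μ) := by
    simp [hξ, Matrix.transpose_mul, hμt, hνt, hRt, mul_assoc]
  have hcξ : c⁻¹ • ξ = (1 - c • N) * R * N.transpose * (1 + c • N) := by
    rw [hξ, hμ, ← hν]
    simp [hc0]
  refine ⟨c⁻¹ • ξ, ?_, ?_, ?_⟩
  · rw [hcξ]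
    have hinv : toC R = (1 + (4 * (α : ℂ) ^ 2)⁻¹ • ((toC N).transpose * toC N))⁻¹ := by
      symm
      apply Matrix.inv_eq_right_inv
      have e : 1 + (4 * (α : ℂ) ^ 2)⁻¹ • ((toC N).transpose * toC N) = toC (1 + μ * ν) := by
        rw [hμν, toC_transpose, ← toC_mul]
        ext p q
        by_cases h : p = q <;> simp [h]
      rw [e, ← toC_mul, hR]
      ext p q
      by_cases h : p = q <;> simp [Matrix.one_apply, h]
    have e1 : toC (1 - c • N) = 1 - (2 * (α : ℂ))⁻¹ • toC N := by
      ext p q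
      by_cases h : p = q <;> simp [h, hc]
    have e2 : toC (1 + c • N) = 1 + (2 * (α : ℂ))⁻¹ • toC N := by
      ext p q
      by_cases h : p = q <;> simp [h, hc]
    rw [toC_mul, toC_mul, toC_mul, e1, e2, hinv]
    rfl
  · rw [smul_mul_smul_comm, twist_mul_self hνν hμμ hR, smul_zero]
  · intro u w huw
    have hmapC : ∀ (a : ℝ) (B : RMat n), toC (a • B) = (a : ℂ) • toC B := fun a B => by ext; simp
    have hadd : ∀ B C : RMat n, toC (B + C) = toC B + toC C := fun B C => by ext; simp
    have s1 : ξ - ξ * ν = μ - ξ.transpose * μ := by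
      rw [hξt]; exact twist_residue_neg hνν hμμ hR
    have s2 : ν + ξ * ν = ξ.transpose + ξ.transpose * μ := by
      rw [hξt]; exact twist_residue_pos hνν hμμ hR hR'
    have r1 := congrArg toC s1
    have r2 := congrArg toC s2
    rw [toC_sub, toC_sub, toC_mul ξ ν, toC_mul ξ.transpose μ] at r1
    rw [hadd, hadd, toC_mul ξ ν, toC_mul ξ.transpose μ] at r2
    have hcC : (c : ℂ) ≠ 0 := by exact_mod_cast hc0
    have hαc : (2 * α : ℂ) = (c : ℂ)⁻¹ := by rw [hc]; simp
    have eN : toC N = (c : ℂ)⁻¹ • toC ν := by rw [hν, hmapC, inv_smul_smul₀ hcC]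
    have eM : (toC N).transpose = (c : ℂ)⁻¹ • toC μ := by
      rw [hμ, hmapC, inv_smul_smul₀ hcC, toC_transpose]
    have eX : toC (c⁻¹ • ξ) = (c : ℂ)⁻¹ • toC ξ := by rw [hmapC]; simp
    have eY : (toC (c⁻¹ • ξ)).transpose = (c : ℂ)⁻¹ • toC ξ.transpose := by
      rw [eX, Matrix.transpose_smul, toC_transpose]
    rw [eN, eX, ← eX, ← eN, eM, eY, eN, eX]
    -- Partial fractions: with `2α u w = u - w` both products become linear in `u` and `w`, and
    -- comparing coefficients leaves the two residue identities.
    have hk : (w * (c : ℂ)⁻¹) * (u * (c : ℂ)⁻¹) = (u - w) * (c : ℂ)⁻¹ := by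
      rw [← huw, hαc]; ring
    have hk' : (u * (c : ℂ)⁻¹) * (w * (c : ℂ)⁻¹) = (u - w) * (c : ℂ)⁻¹ := by
      rw [mul_comm, hk]
    simp only [mul_add, add_mul, one_mul, mul_one, smul_smul, smul_mul_smul_comm, hk, hk']
    generalize toC ξ * toC ν = a at r1 r2 ⊢
    generalize toC ξ.transpose * toC μ = b at r1 r2 ⊢
    have r1' : toC ξ = toC μ - b + a := by rw [← r1]; abel
    have r2' : toC ν = toC ξ.transpose + b - a := by rw [← r2]; abel
    rw [r1', r2']
    module

end Twist

/-! ### The reality condition. -/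

section Reality

variable {n : ℕ}

/-- Entrywise complex conjugation. -/
noncomputable def conjMat (n : ℕ) : CMat n →+* CMat n := (starRingEnd ℂ).mapMatrix

@[simp] theorem conjMat_apply (A : CMat n) (p q : Fin n) :
    conjMat n A p q = starRingEnd ℂ (A p q) := rfl

@[simp] theorem conjMat_toC (A : RMat n) : conjMat n (toC A) = toC A := by
  ext; simp

theorem conjMat_smul (c : ℂ) (A : CMat n) : conjMat n (c • A) = starRingEnd ℂ c • conjMat n A := by
  ext; simp

theorem continuous_conjMat : Continuous (conjMat n) :=
  continuous_matrix fun p q => Complex.continuous_conj.comp (continuous_id.matrix_elem p q)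

theorem conjMat_ringInverse {A : CMat n} (h : conjMat n A = A) :
    conjMat n (Ring.inverse A) = Ring.inverse A := by
  by_cases hA : IsUnit A
  · have h1 : conjMat n (Ring.inverse A) * A = 1 := by
      conv_lhs => rw [← h, h]
      nth_rewrite 2 [← h]
      rw [← map_mul, Ring.inverse_mul_cancel _ hA, map_one]
    calc conjMat n (Ring.inverse A) = conjMat n (Ring.inverse A) * (A * Ring.inverse A) := by
          rw [Ring.mul_inverse_cancel _ hA, mul_one]
      _ = Ring.inverse A := by rw [← mul_assoc, h1, one_mul]
  · simp [Ring.inverse_non_unit _ hA]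

/-- The reality condition `conj f(conj z) = f(z)`. -/
def IsRealLoop (f : ℂ → CMat n) : Prop := ∀ z, conjMat n (f (starRingEnd ℂ z)) = f z

theorem IsRealLoop.apply_ofReal {f : ℂ → CMat n} (hf : IsRealLoop f) (α : ℝ) :
    conjMat n (f α) = f α := by
  simpa using hf α

theorem IsRealLoop.logDerivAt {f : ℂ → CMat n} (hf : IsRealLoop f) (hd : Differentiable ℂ f)
    (α : ℝ) : conjMat n (logDerivAt f α) = logDerivAt f α := by
  set g : ℂ → CMat n := fun z => f z * Ring.inverse (f α)
  have hg : IsRealLoop g := fun z => by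
    simp only [g, map_mul, hf z, conjMat_ringInverse (hf.apply_ofReal α)]
  have hgd : HasDerivAt g (_root_.logDerivAt f α) α := ((hd α).mul_const _).hasDerivAt
  ext p q
  have h1 : HasDerivAt (fun z => g z p q) (_root_.logDerivAt f α p q) α :=
    (entryCLM ℂ p q).hasFDerivAt.comp_hasDerivAt _ hgd
  have h2 := h1.conj_conj
  rw [Complex.conj_ofReal] at h2
  refine (h2.congr_of_eventuallyEq (Eventually.of_forall fun z => ?_)).unique h1
  rw [← hg z]
  rfl

theorem IsRealLoop.dressedNil {f : ℂ → CMat n} (hf : IsRealLoop f) (hd : Differentiable ℂ f)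
    (α : ℝ) {N : CMat n} (hN : conjMat n N = N) :
    conjMat n (dressedNil f α N) = dressedNil f α N := by
  simp only [_root_.dressedNil, map_mul, conjMat_ringInverse (hf.apply_ofReal α),
    hf.apply_ofReal α, hN]
  rw [conjMat_ringInverse]
  simp [hN, hf.logDerivAt hd α]

theorem IsRealLoop.dressedLoop {f : ℂ → CMat n} (hf : IsRealLoop f) (hd : Differentiable ℂ f)
    (hu : ∀ z, IsUnit (f z)) (α : ℝ) {N : CMat n} (hNN : N * N = 0) (hN : conjMat n N = N)
    (hW : IsUnit (1 + N * _root_.logDerivAt f α)) : IsRealLoop (dressedLoop f α N) := by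
  have hc := (differentiable_dressedLoop (α := (α : ℂ)) (N := N) hd).continuous
  refine fun z => congrFun (Continuous.ext_on (dense_compl_singleton (α : ℂ))
    (continuous_conjMat.comp (hc.comp Complex.continuous_conj)) hc fun z hz => ?_) z
  have hz' : starRingEnd ℂ z ≠ α := fun h => hz (by
    have := congrArg (starRingEnd ℂ) h
    simpa using this)
  simp only [Function.comp_apply]
  rw [dressedLoop_of_ne (hu α) hd hNN hW hz, dressedLoop_of_ne (hu α) hd hNN hW hz']
  simp only [map_mul, map_add, map_sub, map_one, conjMat_smul, hf z, hN, hf.dressedNil hd α hN,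
    map_inv₀, Complex.conj_conj, Complex.conj_ofReal]

end Reality

/-! ### Symmetry of the sum of residues, by Liouville's theorem. -/

section Symmetry

variable {n : ℕ}

theorem tendsto_inv_sub_cobounded (α : ℂ) :
    Tendsto (fun z : ℂ => (z - α)⁻¹) (Bornology.cobounded ℂ) (𝓝 0) :=
  tendsto_inv₀_cobounded.comp (tendsto_sub_const_cobounded α)

theorem tendsto_mul_inv_sub_cobounded (α : ℂ) :
    Tendsto (fun z : ℂ => z * (z - α)⁻¹) (Bornology.cobounded ℂ) (𝓝 1) := by
  have h : Tendsto (fun z : ℂ => 1 + α * (z - α)⁻¹) (Bornology.cobounded ℂ) (𝓝 1) := by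
    simpa using ((tendsto_inv_sub_cobounded α).const_mul α).const_add 1
  refine h.congr' ?_
  filter_upwards [Bornology.eventually_ne_cobounded α] with z hz
  have := sub_ne_zero.2 hz
  field_simp
  ring

/-- The two residues of a dressing factor compatible with the twisting `f(-z)ᵗ f(z) = 1` have a
symmetric sum. -/
theorem residue_sum_symmetric {A B : CMat n} (hA : A * A = 0) (hB : B * B = 0) {α : ℂ}
    {G g : ℂ → CMat n} (hG : Differentiable ℂ G)
    (hg : ∀ z, z ≠ α → z ≠ -α → (g (-z)).transpose * g z = 1)
    (hGg : ∀ z, z ≠ α → z ≠ -α →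
      G z = g z * (1 - (z - α)⁻¹ • A) * (1 - (z + α)⁻¹ • B)) :
    (A + B).transpose = A + B := by
  have hne : ∀ᶠ z in Bornology.cobounded ℂ, z ≠ α ∧ z ≠ -α :=
    (Bornology.eventually_ne_cobounded α).and (Bornology.eventually_ne_cobounded (-α))
  have hu := tendsto_inv_sub_cobounded α
  have hw := tendsto_inv_sub_cobounded (-α)
  simp only [sub_neg_eq_add] at hw
  -- `K` is entire. Off `±α` the twisting of `g` cancels the inner factors, leaving an expression in
  -- `A` and `B` that tends to `1` at infinity; hence `K = 1`.
  set K : ℂ → CMat n := fun z => (G (-z)).transpose * G z with hK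
  have hK' : ∀ z, z ≠ α → z ≠ -α → K z =
      ((1 + (z - α)⁻¹ • B.transpose) * (1 + (z + α)⁻¹ • A.transpose)) *
        ((1 - (z - α)⁻¹ • A) * (1 - (z + α)⁻¹ • B)) := by
    intro z h1 h2
    have h1' : -z ≠ -α := fun h => h1 (neg_injective h)
    have h2' : -z ≠ α := fun h => h2 (by rw [← h, neg_neg])
    have e1 : (-z - α)⁻¹ = -(z + α)⁻¹ := by rw [← inv_neg]; congr 1; ring
    have e2 : (-z + α)⁻¹ = -(z - α)⁻¹ := by rw [← inv_neg]; congr 1; ring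
    simp only [hK]
    rw [hGg z h1 h2, hGg (-z) h2' h1', e1, e2]
    simp only [neg_smul, sub_neg_eq_add, Matrix.transpose_mul, Matrix.transpose_add,
      Matrix.transpose_one, Matrix.transpose_smul]
    calc _ = (1 + (z - α)⁻¹ • B.transpose) * (1 + (z + α)⁻¹ • A.transpose) *
          ((g (-z)).transpose * g z) * ((1 - (z - α)⁻¹ • A) * (1 - (z + α)⁻¹ • B)) := by
          simp only [mul_assoc]
      _ = _ := by rw [hg z h1 h2, mul_one]
  have hKd : Differentiable ℂ K := by
    refine Differentiable.mul (fun z => ?_) hG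
    have hGm : DifferentiableAt ℂ (fun z => G (-z)) z := (hG (-z)).comp z differentiableAt_id.neg
    exact differentiableAt_entries_iff.2 fun p q => differentiableAt_entries_iff.1 hGm q p
  have hKlim : Tendsto K (Bornology.cobounded ℂ) (𝓝 1) := by
    have hc : Continuous fun r : ℂ × ℂ =>
        ((1 + r.1 • B.transpose) * (1 + r.2 • A.transpose)) * ((1 - r.1 • A) * (1 - r.2 • B)) := by
      fun_prop
    have := (hc.tendsto (0, 0)).comp (hu.prodMk_nhds hw)
    simp only [zero_smul, add_zero, sub_zero, mul_one] at this
    refine this.congr' ?_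
    filter_upwards [hne] with z hz
    exact (hK' z hz.1 hz.2).symm
  have hK1 : ∀ z, K z = 1 := fun z => by
    rw [Metric.cobounded_eq_cocompact] at hKlim
    exact hKd.apply_eq_of_tendsto_cocompact z hKlim
  have key : ∀ z, z ≠ α → z ≠ -α →
      (1 + (z - α)⁻¹ • B.transpose) * (1 + (z + α)⁻¹ • A.transpose)
        = (1 + (z + α)⁻¹ • B) * (1 + (z - α)⁻¹ • A) := by
    intro z h1 h2
    have h := (hK' z h1 h2).symm.trans (hK1 z)
    set P := (1 + (z - α)⁻¹ • B.transpose) * (1 + (z + α)⁻¹ • A.transpose)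
    have hinv : ((1 - (z - α)⁻¹ • A) * (1 - (z + α)⁻¹ • B)) *
        ((1 + (z + α)⁻¹ • B) * (1 + (z - α)⁻¹ • A)) = 1 := by
      have a1 := mul_eq_one_comm.1 (one_add_smul_mul_one_sub_smul hA (z - α)⁻¹)
      have b1 := mul_eq_one_comm.1 (one_add_smul_mul_one_sub_smul hB (z + α)⁻¹)
      rw [mul_assoc, ← mul_assoc (1 - (z + α)⁻¹ • B), b1, one_mul, a1]
    calc P = P * (((1 - (z - α)⁻¹ • A) * (1 - (z + α)⁻¹ • B)) *
        ((1 + (z + α)⁻¹ • B) * (1 + (z - α)⁻¹ • A))) := by rw [hinv, mul_one]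
      _ = _ := by rw [← mul_assoc, h, one_mul]
  have hzu := tendsto_mul_inv_sub_cobounded α
  have hzw := tendsto_mul_inv_sub_cobounded (-α)
  simp only [sub_neg_eq_add] at hzw
  -- The first-order term at infinity: multiplied by `z`, the product of two simple factors minus
  -- `1` tends to the sum of the residues, since the mixed term is of order `z⁻²`.
  have lim : ∀ C D : CMat n, Tendsto (fun z : ℂ => (z * (z - α)⁻¹) • C + (z * (z + α)⁻¹) • D +
      ((z * (z - α)⁻¹) * (z + α)⁻¹) • (C * D)) (Bornology.cobounded ℂ) (𝓝 (C + D)) := by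
    intro C D
    simpa using ((hzu.smul_const C).add (hzw.smul_const D)).add ((hzu.mul hw).smul_const (C * D))
  have lim' : ∀ C D : CMat n, Tendsto (fun z : ℂ => (z * (z - α)⁻¹) • C + (z * (z + α)⁻¹) • D +
      ((z * (z - α)⁻¹) * (z + α)⁻¹) • (D * C)) (Bornology.cobounded ℂ) (𝓝 (C + D)) := by
    intro C D
    simpa using ((hzu.smul_const C).add (hzw.smul_const D)).add ((hzu.mul hw).smul_const (D * C))
  have hEq := tendsto_nhds_unique ((lim B.transpose A.transpose).congr' ?_) (lim' A B)
  · rw [Matrix.transpose_add, add_comm, hEq]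
  · filter_upwards [hne] with z hz
    have h := congrArg (fun M : CMat n => z • (M - 1)) (key z hz.1 hz.2)
    simp only [mul_add, add_mul, one_mul, mul_one, smul_mul_smul_comm] at h
    calc _ = z • ((1 + (z - α)⁻¹ • B.transpose + ((z + α)⁻¹ • A.transpose +
          ((z - α)⁻¹ * (z + α)⁻¹) • (B.transpose * A.transpose)) - 1 : CMat n)) := by module
      _ = z • ((1 + (z + α)⁻¹ • B + ((z - α)⁻¹ • A + ((z + α)⁻¹ * (z - α)⁻¹) • (B * A)) - 1
          : CMat n)) := h
      _ = _ := by module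

end Symmetry

/-! ### Twisting and reality of the frame. -/

section FrameSymmetries

variable {n : ℕ}

theorem HasDifferential.transpose {F : Pt n → CMat n} {L : AlgForm (Pt n) (CMat n)} {x : Pt n}
    (h : HasDifferential F L x) :
    HasDifferential (fun y => (F y).transpose)
      (formOf fun i => (L (Pi.single i 1)).transpose) x := by
  rw [hasFDerivAt_matrix_iff] at h ⊢
  refine ⟨fun p q => h.1 q p, fun i => ?_⟩
  rw [formOf_single, ← h.2 i]
  rfl

theorem HasDifferential.conjMat {F : Pt n → CMat n} {L : AlgForm (Pt n) (CMat n)} {x : Pt n}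
    (h : HasDifferential F L x) :
    HasDifferential (fun y => conjMat n (F y)) (formOf fun i => conjMat n (L (Pi.single i 1))) x := by
  rw [hasFDerivAt_matrix_iff] at h ⊢
  have hc : ∀ p q, HasFDerivAt (fun y => _root_.conjMat n (F y) p q)
      ((Complex.conjCLE : ℂ →L[ℝ] ℂ).comp (fderiv ℝ (fun y => F y p q) x)) x := fun p q =>
    (Complex.conjCLE : ℂ →L[ℝ] ℂ).hasFDerivAt.comp x (h.1 p q).hasFDerivAt
  refine ⟨fun p q => (hc p q).differentiableAt, fun i => ?_⟩
  rw [formOf_single, ← h.2 i]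
  ext p q
  simp only [pderiv, Matrix.of_apply, (hc p q).fderiv]
  rfl

theorem eqOn_of_hasDifferential_zero {X 𝔸 : Type*} [NormedAddCommGroup X] [NormedSpace ℝ X]
    [NormedRing 𝔸] [NormedAlgebra ℂ 𝔸] {U : Set X} (hU : IsOpen U) (hUc : IsPreconnected U)
    {F : X → 𝔸} (hF : ∀ x ∈ U, HasDifferential F 0 x) {x y : X} (hx : x ∈ U) (hy : y ∈ U) :
    F x = F y :=
  hU.is_const_of_fderiv_eq_zero (𝕜 := ℝ) hUc
    (fun z hz => (hF z hz).differentiableAt.differentiableWithinAt)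
    (fun z hz => (hF z hz).fderiv) hx hy

/-- Solutions of two linear equations with skew-adjoint potentials are inverse to each other up to
transposition. -/
theorem mul_transpose_eq_one {U : Set (Pt n)} (hU : IsOpen U) (hUc : IsPreconnected U)
    (h0 : (0 : Pt n) ∈ U) {Y W : Pt n → CMat n} {L M : Pt n → AlgForm (Pt n) (CMat n)}
    (hY : ∀ x ∈ U, HasDifferential Y (leftMul (Y x) (L x)) x)
    (hW : ∀ x ∈ U, HasDifferential W (leftMul (W x) (M x)) x)
    (hLM : ∀ x ∈ U, ∀ i, L x (Pi.single i 1) + (M x (Pi.single i 1)).transpose = 0)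
    (hY0 : Y 0 = 1) (hW0 : W 0 = 1) {x : Pt n} (hx : x ∈ U) : Y x * (W x).transpose = 1 := by
  have h1 : ∀ x ∈ U, HasDifferential (fun y => Y y * (W y).transpose) 0 x := fun x hx => by
    refine ((hY x hx).mul_leftMul (hW x hx).transpose).congr_fderiv (form_ext fun i => ?_)
    have h2 := hLM x hx i
    simp only [add_apply, leftMul_apply, rightMul_apply, formOf_single, zero_apply,
      Matrix.transpose_mul]
    calc _ = Y x * (L x (Pi.single i 1) + (M x (Pi.single i 1)).transpose) * (W x).transpose := by
          noncomm_ring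
      _ = 0 := by rw [h2, mul_zero, zero_mul]
  have h3 := eqOn_of_hasDifferential_zero hU hUc h1 hx h0
  simpa [hY0, hW0] using h3

theorem lie_diagUnit_transpose {B : RMat n} (hB : B.IsSymm) (i : Fin n) :
    (toC ⁅diagUnit i, B⁆).transpose = -toC ⁅diagUnit i, B⁆ := by
  ext p q
  simp only [Matrix.transpose_apply, toC_apply, Matrix.neg_apply, lie_diagUnit_apply, hB.apply]
  push_cast
  ring

theorem toC_diagUnit_transpose (i : Fin n) :
    (toC (diagUnit i)).transpose = toC (diagUnit i) := by
  rw [toC_transpose, diagUnit, Matrix.transpose_single]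

section

variable {U : Set (Pt n)} {β : Pt n → RMat n} {E : Pt n → ℂ → CMat n}

/-- As `a_i` is symmetric and `[a_i, β]` is skew, the potential at `z` and the transposed potential
at `-z` add up to zero. -/
theorem frame_mul_transpose (hE : IsFrame U β E) (hβ : IsSolution U β) (hU : IsOpen U)
    (hUc : IsPreconnected U) (h0 : (0 : Pt n) ∈ U) {x : Pt n} (hx : x ∈ U) (z : ℂ) :
    E x z * (E x (-z)).transpose = 1 := by
  refine mul_transpose_eq_one hU hUc h0 (Y := fun y => E y z) (W := fun y => E y (-z))
    (fun y hy => hE.hasFDerivAt hU hy z) (fun y hy => hE.hasFDerivAt hU hy (-z))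
    (fun y hy i => ?_) (hE.init z) (hE.init (-z)) hx
  simp only [add_apply, smul_apply, diagForm, potential, formOf_single, Matrix.transpose_add,
    Matrix.transpose_smul, toC_diagUnit_transpose, lie_diagUnit_transpose (hβ.symm y hy)]
  module

/-- Since `a_i` and `β` are real, `conj E(x, conj z)` solves the same equation as `E(x, z)`. Both
are therefore inverse to `E(x, -z)ᵗ`, hence equal. -/
theorem frame_isRealLoop (hE : IsFrame U β E) (hβ : IsSolution U β) (hU : IsOpen U)
    (hUc : IsPreconnected U) (h0 : (0 : Pt n) ∈ U) {x : Pt n} (hx : x ∈ U) :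
    IsRealLoop (E x) := by
  intro z
  have h1 : conjMat n (E x (starRingEnd ℂ z)) * (E x (-z)).transpose = 1 := by
    refine mul_transpose_eq_one hU hUc h0 (Y := fun y => conjMat n (E y (starRingEnd ℂ z)))
      (L := fun y => z • diagForm n + potential β y)
      (W := fun y => E y (-z)) (fun y hy => ?_) (fun y hy => hE.hasFDerivAt hU hy (-z))
      (fun y hy i => ?_) (by simp [hE.init]) (hE.init (-z)) hx
    · refine (HasDifferential.conjMat (hE.hasFDerivAt hU hy _)).congr_fderiv
        (form_ext fun i => ?_)
      simp [diagForm, potential, conjMat_smul]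
    · simp only [add_apply, smul_apply, diagForm, potential, formOf_single, Matrix.transpose_add,
        Matrix.transpose_smul, toC_diagUnit_transpose, lie_diagUnit_transpose (hβ.symm y hy)]
      module
  have h2 := frame_mul_transpose hE hβ hU hUc h0 hx z
  calc _ = conjMat n (E x (starRingEnd ℂ z)) * ((E x (-z)).transpose * E x z) := by
        rw [mul_eq_one_comm.1 h2, mul_one]
    _ = _ := by rw [← mul_assoc, h1, one_mul]

end

end FrameSymmetries

/-! ### From flat potentials to solutions of the system. -/

section Solutions

variable {n : ℕ}

theorem hasDifferential_potential {β : Pt n → RMat n} {x : Pt n}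
    (hβ : ∀ p q, DifferentiableAt ℝ (fun y => β y p q) x) (i : Fin n) :
    HasDifferential (fun y => potential β y (Pi.single i 1))
      (formOf fun j => toC ⁅diagUnit i, pderiv j β x⁆) x := by
  have hc : ∀ p q, HasFDerivAt (fun y => potential β y (Pi.single i 1) p q)
      (Complex.ofRealCLM.comp
        (((if i = p then (1 : ℝ) else 0) - (if i = q then 1 else 0)) •
          fderiv ℝ (fun y => β y p q) x)) x := fun p q => by
    refine (Complex.ofRealCLM.hasFDerivAt.comp x
      ((hβ p q).hasFDerivAt.const_mul _)).congr_of_eventuallyEq (Eventually.of_forall fun y => ?_)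
    simp only [potential, formOf_single, toC_apply, lie_diagUnit_apply]
    rfl
  refine hasFDerivAt_matrix_iff.2 ⟨fun p q => (hc p q).differentiableAt, fun j => ?_⟩
  ext p q
  rw [formOf_single, toC_apply, lie_diagUnit_apply]
  simp only [pderiv, Matrix.of_apply, (hc p q).fderiv]
  simp

/-- The potential of a frame solves the `GL(n)/O(n)`-system. -/
theorem isSolution_of_isLaxFrame {V : Set (Pt n)} {β : Pt n → RMat n} {F : Pt n → ℂ → CMat n}
    (hF : IsLaxFrame V (diagForm n) (potential β) F)
    (hs : ∀ p q, ContDiffOn ℝ ∞ (fun x => β x p q) V) (hsymm : ∀ x ∈ V, (β x).IsSymm)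
    (hdiag : ∀ x ∈ V, ∀ p, β x p p = 0) : IsSolution V β where
  smooth := hs
  symm := hsymm
  diag := hdiag
  eqn x hx i j := by
    have hd : ∀ p q, DifferentiableAt ℝ (fun y => β y p q) x := fun p q =>
      ((hs p q).contDiffAt (hF.isOpen.mem_nhds hx)).differentiableAt (by simp)
    have h := hF.curvature_eq_zero hx (hasDifferential_potential hd j)
      (hasDifferential_potential hd i)
    simp only [potential, formOf_single] at h
    apply toC_injective
    rw [toC_sub, Ring.lie_def ⁅diagUnit i, β x⁆, toC_sub, toC_mul, toC_mul]
    exact h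

theorem lie_diagUnit_offDiag (i : Fin n) (B : RMat n) :
    ⁅diagUnit i, offDiag B⁆ = ⁅diagUnit i, B⁆ := by
  ext p q
  rw [lie_diagUnit_apply, lie_diagUnit_apply]
  by_cases h : p = q
  · simp [h]
  · simp [offDiag, h]

/-- Two dressing steps subtract `[a_i, S + S']` from the `i`-th component; diagonal matrices commute
with `a_i`, so passing to the off-diagonal part costs nothing. -/
theorem dressedPotential_potential {β T : Pt n → RMat n} {S S' : Pt n → CMat n} {x : Pt n}
    (hT : toC (T x) = S x + S' x) :
    dressedPotential (diagForm n) (dressedPotential (diagForm n) (potential β) S) S' x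
      = potential (fun y => β y - offDiag (T y)) x := by
  refine form_ext fun i => ?_
  have h1 : ⁅diagUnit i, β x - offDiag (T x)⁆ = ⁅diagUnit i, β x⁆ - ⁅diagUnit i, T x⁆ := by
    rw [← lie_diagUnit_offDiag i (T x)]
    ext p q
    simp only [lie_diagUnit_apply, Matrix.sub_apply]
    ring
  simp only [dressedPotential, sub_apply, leftMul_apply, rightMul_apply, diagForm, potential,
    formOf_single]
  rw [h1, toC_sub, Ring.lie_def _ (T x), toC_sub, toC_mul, toC_mul, hT]
  noncomm_ring

end Solutions

/-! ### Rational and entire loops, and the twisting of `s_{α,N}`. -/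

section Loops

variable {n : ℕ}

theorem isNegLoop_mElt_mul_mElt (α β : ℂ) (A B : CMat n) :
    IsNegLoop fun z => mElt α A z * mElt β B z := by
  constructor
  · intro p q
    set Q : Polynomial ℂ := (Polynomial.X - Polynomial.C α) * (Polynomial.X - Polynomial.C β)
    set P : Matrix (Fin n) (Fin n) (Polynomial ℂ) :=
      ((Polynomial.X - Polynomial.C α) • 1 + A.map Polynomial.C) *
        ((Polynomial.X - Polynomial.C β) • 1 + B.map Polynomial.C)
    have hPm : ∀ z, (Polynomial.evalRingHom z).mapMatrix P
        = ((z - α) • 1 + A) * ((z - β) • 1 + B) := by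
      intro z
      rw [map_mul]
      congr 1 <;>
      · ext a b
        by_cases h : a = b <;> simp [h]
    refine ⟨P p q, Q, mul_ne_zero (Polynomial.X_sub_C_ne_zero _) (Polynomial.X_sub_C_ne_zero _),
      fun z hz => ?_⟩
    simp only [Q, Polynomial.eval_mul, Polynomial.eval_sub, Polynomial.eval_X,
      Polynomial.eval_C] at hz ⊢
    have hα := left_ne_zero_of_mul hz
    have hβ := right_ne_zero_of_mul hz
    have hP : (P p q).eval z = (((z - α) • 1 + A) * ((z - β) • 1 + B)) p q := by
      rw [← hPm]; rfl
    have e1 : (z - α) • (1 : CMat n) + A = (z - α) • mElt α A z := by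
      rw [mElt, smul_add, smul_inv_smul₀ hα]
    have e2 : (z - β) • (1 : CMat n) + B = (z - β) • mElt β B z := by
      rw [mElt, smul_add, smul_inv_smul₀ hβ]
    rw [hP, e1, e2, smul_mul_smul_comm, Matrix.smul_apply, smul_eq_mul,
      mul_div_cancel_left₀ _ hz]
  · intro p q
    have hc : Continuous fun r : ℂ × ℂ => ((1 + r.1 • A) * (1 + r.2 • B)) := by fun_prop
    have := ((continuous_entries hc p q).tendsto (0, 0)).comp
      ((tendsto_inv_sub_cobounded α).prodMk_nhds (tendsto_inv_sub_cobounded β))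
    simp only [zero_smul, add_zero, mul_one] at this
    exact this

theorem isPosLoop_of_differentiable {f : ℂ → CMat n} (hd : Differentiable ℂ f)
    (hu : ∀ z, IsUnit (f z)) : IsPosLoop f :=
  ⟨fun p q z => differentiableAt_entries_iff.1 (hd z) p q, hu⟩

theorem two_mul_mul_inv_sub_inv {α z : ℂ} (h1 : z ≠ α) (h2 : z ≠ -α) :
    2 * α * ((z - α)⁻¹ * (z + α)⁻¹) = (z - α)⁻¹ - (z + α)⁻¹ := by
  have h1' := sub_ne_zero.2 h1
  have h2' : z + α ≠ 0 := fun h => h2 (eq_neg_of_add_eq_zero_left h)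
  field_simp
  ring

/-- With `u = (z - α)⁻¹` and `w = (z + α)⁻¹`, replacing `z` by `-z` exchanges `u` with `-w`. The
inverse of `s(-z)ᵗ` is thus `(1 + u N'ᵗ)(1 + w Nᵗ)`, which equals `s(z)` by the choice of `N'`. -/
theorem sElt_transpose_mul_sElt {α : ℝ} (hα : α ≠ 0) {N : RMat n} (hN : N * N = 0) {z : ℂ}
    (h1 : z ≠ α) (h2 : z ≠ -α) :
    (sElt α (toC N) (-z)).transpose * sElt α (toC N) z = 1 := by
  obtain ⟨N', hN', hNN, hs⟩ := exists_twistN_eq_toC hα hN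
  have e1 : (-z - α : ℂ)⁻¹ = -(z + α)⁻¹ := by rw [← inv_neg]; congr 1; ring
  have e2 : (-z + α : ℂ)⁻¹ = -(z - α)⁻¹ := by rw [← inv_neg]; congr 1; ring
  have hM : (toC N).transpose * (toC N).transpose = 0 := by
    rw [← Matrix.transpose_mul, ← toC_mul, hN]; ext; simp
  have hM' : (toC N').transpose * (toC N').transpose = 0 := by
    rw [← Matrix.transpose_mul, ← toC_mul, hNN]; ext; simp
  simp only [sElt, mElt, ← hN', sub_neg_eq_add]
  rw [hs _ _ (two_mul_mul_inv_sub_inv h1 h2), e1, e2]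
  simp only [neg_smul, Matrix.transpose_mul, Matrix.transpose_add, Matrix.transpose_one,
    Matrix.transpose_neg, Matrix.transpose_smul]
  simp only [← sub_eq_add_neg]
  have a1 := mul_eq_one_comm.1 (one_add_smul_mul_one_sub_smul hM (z + α)⁻¹)
  have a2 := mul_eq_one_comm.1 (one_add_smul_mul_one_sub_smul hM' (z - α)⁻¹)
  rw [mul_assoc, ← mul_assoc (1 - (z - (α : ℂ))⁻¹ • (toC N').transpose), a2, one_mul, a1]

theorem trace_eq_zero_of_mul_self {A : CMat n} (hA : A * A = 0) : A.trace = 0 :=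
  (Matrix.isNilpotent_trace_of_isNilpotent ⟨2, by rw [pow_two, hA]⟩).eq_zero

end Loops

theorem mainTheorem9 (n : ℕ) (U : Set (Pt n)) (hU : IsOpen U) (hUc : IsPreconnected U)
    (h0 : (0 : Pt n) ∈ U) (β : Pt n → RMat n) (hβ : IsSolution U β)
    (E : Pt n → ℂ → CMat n) (hE : IsFrame U β E)
    (α : ℝ) (hα : α ≠ 0) (N : RMat n) (hN : N * N = 0) :
    IsOpen (goodSet U E α (toC N)) ∧ (0 : Pt n) ∈ goodSet U E α (toC N) ∧
    ∃ (T : Pt n → RMat n) (E' : Pt n → ℂ → CMat n),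
      (∀ x ∈ goodSet U E α (toC N),
        toC (T x) = tildeN (E x) α (toC N) + tildeN' (E x) α (toC N) ∧
        (T x).IsSymm ∧ (T x).trace = 0) ∧
      IsSolution (goodSet U E α (toC N)) (fun x => β x - offDiag (T x)) ∧
      IsFrame (goodSet U E α (toC N)) (fun x => β x - offDiag (T x)) E' ∧
      (∀ x ∈ goodSet U E α (toC N), IsDressing (sElt α (toC N)) (E x) (E' x)) ∧
      (∀ x ∈ goodSet U E α (toC N), ∀ z : ℂ, z ≠ α → z ≠ -α →
        E' x z = sElt α (toC N) z * E x z * (mElt α (tildeN (E x) α (toC N)) z)⁻¹ *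
          (mElt (-α) (tildeN' (E x) α (toC N)) z)⁻¹) := by
  have hEL := hE.isLaxFrame hβ hU hUc h0
  obtain ⟨N', hN', hNN', -⟩ := exists_twistN_eq_toC hα hN
  have hNc : toC N * toC N = 0 := by rw [← toC_mul, hN]; ext; simp
  have hNc' : toC N' * toC N' = 0 := by rw [← toC_mul, hNN']; ext; simp
  have hαα : (-α : ℂ) ≠ α := fun h => hα (by
    have h' : (-α : ℝ) = α := by exact_mod_cast h
    linarith)
  set F : Pt n → ℂ → CMat n := fun x => dressedLoop (E x) α (toC N) with hFdef
  have hFL := hEL.dress (α := α) hNc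
  rw [← hFdef] at hFL
  set E' : Pt n → ℂ → CMat n := fun x => dressedLoop (F x) (-α) (toC N') with hE'def
  have hGL := hFL.dress (α := -α) hNc'
  rw [← hE'def] at hGL
  set S : Pt n → CMat n := fun x => dressedNil (E x) α (toC N) with hS
  set S' : Pt n → CMat n := fun x => dressedNil (F x) (-α) (toC N') with hS'
  -- The set of good points is the domain of the twice dressed Lax frame.
  have hgood : goodSet U E α (toC N) = {x ∈ {x ∈ U | IsUnit (1 + toC N * logDerivAt (E x) α)} |
      IsUnit (1 + toC N' * logDerivAt (F x) (-α))} := by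
    ext x
    simp only [goodSet, Set.mem_ofPred_eq]
    constructor
    · rintro ⟨hx, h1, h2⟩
      have h1' := (wellDefined_iff (hEL.differentiable x hx)).1 h1
      rw [← hN', wellDefined_dressLoop_iff (hEL.isUnit x hx) (hEL.differentiable x hx) hNc h1'
        hαα] at h2
      exact ⟨⟨hx, h1'⟩, h2⟩
    · rintro ⟨⟨hx, h1⟩, h2⟩
      refine ⟨hx, (wellDefined_iff (hEL.differentiable x hx)).2 h1, ?_⟩
      rw [← hN', wellDefined_dressLoop_iff (hEL.isUnit x hx) (hEL.differentiable x hx) hNc h1 hαα]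
      exact h2
  rw [← hgood] at hGL
  have hmem : ∀ x ∈ goodSet U E α (toC N), x ∈ U ∧ IsUnit (1 + toC N * logDerivAt (E x) α) ∧
      IsUnit (1 + toC N' * logDerivAt (F x) (-α)) := fun x hx => by
    rw [hgood] at hx
    exact ⟨hx.1.1, hx.1.2, hx.2⟩
  have hFx : ∀ x ∈ goodSet U E α (toC N), (∀ z, IsUnit (F x z)) ∧ Differentiable ℂ (F x) :=
    fun x hx => ⟨hFL.isUnit x ⟨(hmem x hx).1, (hmem x hx).2.1⟩,
      hFL.differentiable x ⟨(hmem x hx).1, (hmem x hx).2.1⟩⟩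
  have hSt : ∀ x ∈ goodSet U E α (toC N), tildeN (E x) α (toC N) = S x := fun x hx =>
    dressN_eq (hEL.differentiable x (hmem x hx).1 α) _
  have hSt' : ∀ x ∈ goodSet U E α (toC N), tildeN' (E x) α (toC N) = S' x := fun x hx => by
    rw [tildeN', ← hN']
    exact dressN_dressLoop_eq (hEL.isUnit x (hmem x hx).1) (hEL.differentiable x (hmem x hx).1)
      hNc (hmem x hx).2.1 hαα _
  have hSS : ∀ x ∈ goodSet U E α (toC N), S x * S x = 0 := fun x hx =>
    dressedNil_mul_self (hEL.isUnit x (hmem x hx).1 _) hNc (hmem x hx).2.1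
  have hSS' : ∀ x ∈ goodSet U E α (toC N), S' x * S' x = 0 := fun x hx =>
    dressedNil_mul_self ((hFx x hx).1 _) hNc' (hmem x hx).2.2
  have hform : ∀ x ∈ goodSet U E α (toC N), ∀ z : ℂ, z ≠ α → z ≠ -α →
      E' x z = sElt α (toC N) z * E x z * (1 - (z - α)⁻¹ • S x) * (1 - (z + α)⁻¹ • S' x) := by
    intro x hx z h1 h2
    have a1 : E' x z = _ := dressedLoop_of_ne ((hFx x hx).1 _) (hFx x hx).2 hNc' (hmem x hx).2.2 h2
    have a2 : F x z = _ := dressedLoop_of_ne (hEL.isUnit x (hmem x hx).1 _)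
      (hEL.differentiable x (hmem x hx).1) hNc (hmem x hx).2.1 h1
    rw [a1, a2, sElt, mElt, mElt, ← hN']
    simp only [sub_neg_eq_add, mul_assoc, hS, hS']
  have hreal : ∀ x ∈ goodSet U E α (toC N), conjMat n (S x + S' x) = S x + S' x := by
    intro x hx
    have hr := frame_isRealLoop hE hβ hU hUc h0 (hmem x hx).1
    have hFr : IsRealLoop (F x) := hr.dressedLoop (hEL.differentiable x (hmem x hx).1)
      (hEL.isUnit x (hmem x hx).1) α hNc (conjMat_toC N) (hmem x hx).2.1
    have r2 := hFr.dressedNil (hFx x hx).2 (-α) (conjMat_toC N')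
    rw [Complex.ofReal_neg] at r2
    rw [map_add]
    exact congrArg₂ _ (hr.dressedNil (hEL.differentiable x (hmem x hx).1) α (conjMat_toC N)) r2
  -- By `hreal` nothing is lost on the good set; the values of `T` elsewhere play no role.
  set T : Pt n → RMat n := fun x => (S x + S' x).map Complex.re with hT
  have hTC : ∀ x ∈ goodSet U E α (toC N), toC (T x) = S x + S' x := by
    intro x hx
    ext p q
    exact Complex.conj_eq_iff_re.1 (congrFun (congrFun (hreal x hx) p) q)
  have hTsymm : ∀ x ∈ goodSet U E α (toC N), (T x).IsSymm := by
    intro x hx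
    apply toC_injective
    rw [← toC_transpose, hTC x hx]
    refine residue_sum_symmetric (hSS x hx) (hSS' x hx) (hGL.differentiable x hx)
      (g := fun z => sElt α (toC N) z * E x z) (fun z h1 h2 => ?_) (hform x hx)
    have h3 := mul_eq_one_comm.1 (frame_mul_transpose hE hβ hU hUc h0 (hmem x hx).1 z)
    rw [Matrix.transpose_mul, mul_assoc, ← mul_assoc (sElt α (toC N) (-z)).transpose,
      sElt_transpose_mul_sElt hα hN h1 h2, one_mul, h3]
  have hTtr : ∀ x ∈ goodSet U E α (toC N), (T x).trace = 0 := by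
    intro x hx
    have h1 : (toC (T x)).trace = 0 := by
      rw [hTC x hx, Matrix.trace_add, trace_eq_zero_of_mul_self (hSS x hx),
        trace_eq_zero_of_mul_self (hSS' x hx), add_zero]
    have h2 : (toC (T x)).trace = ((T x).trace : ℂ) := by
      simp [Matrix.trace]
    rw [h2] at h1
    exact_mod_cast h1
  have hTsmooth : ∀ p q, ContDiffOn ℝ ∞ (fun x => T x p q) (goodSet U E α (toC N)) := by
    intro p q
    have h1 := contDiffOn_entries (hEL.contDiffOn_dressedNil (α := α) (N := toC N)) p q
    have h2 := contDiffOn_entries (hFL.contDiffOn_dressedNil (α := -α) (N := toC N')) p q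
    rw [← hgood] at h2
    have h1' := h1.mono (t := goodSet U E α (toC N)) fun x hx => ⟨(hmem x hx).1, (hmem x hx).2.1⟩
    exact Complex.reCLM.contDiff.comp_contDiffOn (h1'.add h2)
  have hL : IsLaxFrame (goodSet U E α (toC N)) (diagForm n)
      (potential fun x => β x - offDiag (T x)) E' :=
    hGL.congr_potential fun x hx => dressedPotential_potential (hTC x hx)
  have hE0 : E 0 = fun _ => 1 := funext fun z => hE.init z
  have hF0 : F 0 = fun _ => 1 := by simp only [hFdef, hE0, dressedLoop_one hNc]
  have hE'0 : E' 0 = fun _ => 1 := by simp only [hE'def, hF0, dressedLoop_one hNc']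
  refine ⟨hL.isOpen, ?_, T, E', fun x hx => ⟨?_, hTsymm x hx, hTtr x hx⟩, ?_, ?_, ?_, ?_⟩
  · rw [hgood]
    refine ⟨⟨h0, ?_⟩, ?_⟩
    · rw [hE0, logDerivAt_one, mul_zero, add_zero]; exact isUnit_one
    · rw [hF0, logDerivAt_one, mul_zero, add_zero]; exact isUnit_one
  · rw [hTC x hx, hSt x hx, hSt' x hx]
  · refine isSolution_of_isLaxFrame hL (fun p q => ?_) (fun x hx => ?_) (fun x hx p => ?_)
    · have h1 := (hβ.smooth p q).mono fun x hx => (hmem x hx).1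
      by_cases h : p = q
      · simpa [offDiag, h] using (h ▸ h1)
      · simpa [offDiag, h] using h1.sub (hTsmooth p q)
    · ext p q
      have h1 := (hβ.symm x (hmem x hx).1).apply p q
      have h2 := (hTsymm x hx).apply p q
      by_cases h : p = q
      · simp [h]
      · simp [offDiag, h, Ne.symm h, h1, h2]
    · simp [offDiag, hβ.diag x (hmem x hx).1 p]
  · exact isFrame_of_isLaxFrame hL (fun x _ => rfl) (fun z => by rw [hE'0])
  · intro x hx
    refine ⟨isNegLoop_mElt_mul_mElt _ _ _ _, isPosLoop_of_differentiable
      (hEL.differentiable x (hmem x hx).1) (hEL.isUnit x (hmem x hx).1),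
      isPosLoop_of_differentiable (hL.differentiable x hx) (hL.isUnit x hx),
      -- The right-hand factor of the factorization, inverse off `±α` to the product of the two
      -- factors in `hform`.
      fun z => mElt (-α) (S' x) z * mElt α (S x) z, isNegLoop_mElt_mul_mElt _ _ _ _, ?_⟩
    filter_upwards [(Set.finite_singleton (α : ℂ)).compl_mem_cofinite,
      (Set.finite_singleton (-α : ℂ)).compl_mem_cofinite] with z h1 h2
    rw [hform x hx z h1 h2]
    have a1 := mul_eq_one_comm.1 (one_add_smul_mul_one_sub_smul (hSS x hx) (z - α)⁻¹)
    have a2 := mul_eq_one_comm.1 (one_add_smul_mul_one_sub_smul (hSS' x hx) (z + α)⁻¹)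
    simp only [mElt, sub_neg_eq_add]
    have b : (1 - (z - α : ℂ)⁻¹ • S x) * ((1 - (z + α : ℂ)⁻¹ • S' x) *
        (1 + (z + α : ℂ)⁻¹ • S' x)) * (1 + (z - α : ℂ)⁻¹ • S x) = 1 := by
      rw [a2, mul_one, a1]
    conv_lhs => rw [← mul_one (sElt α (toC N) z * E x z), ← b]
    simp only [mul_assoc]
  · intro x hx z h1 h2
    rw [hform x hx z h1 h2, hSt x hx, hSt' x hx, mElt_inv (hSS x hx), mElt_inv (hSS' x hx),
      sub_neg_eq_add]
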